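/- Let $n\ge 2$. Write $\mathbb{R}^{2,m}$ for $\mathbb{R}^{m+2}$ with the form $\langle v,v\rangle=-u_1^2-u_2^2+x_1^2+\dots+x_m^2$, and let $\mathrm{Ein}_m$ be the space of rays of its cone of nonzero isotropic vectors, identified with $\mathbb{S}^1\times\mathbb{S}^{m-1}$ (the sign of $\langle x,y\rangle$ makes sense for $x,y\in \mathrm{Ein}_m$, and $-x$ is the opposite ray of $x$). A subset of $\mathrm{Ein}_n$ is achronal (resp. acausal) if it is the projection of a subset of $\mathbb{R}\times\mathbb{S}^{n-1}$, with the Lorentzian metric $-d\theta^2+ds^2$, no two distinct points of which are joined by a timelike (resp. causal) curve. Let $\Gamma$ be a group and let $\rho:\Gamma\to \mathrm{SO}_0(2,n)$ be GHC-regular with limit set $\Lambda_\rho$: $\rho$ is faithful with discrete image, and $\Lambda_\rho\subset\mathrm{Ein}_n$ is a $\rho(\Gamma)$-invariant achronal subset homeomorphic to $\mathbb{S}^{n-1}$. Assume that $\Lambda_\rho$ is acausal. Regard $\rho(\gamma)$ as acting on $\mathrm{Ein}_{n+1}\supset\mathrm{Ein}_n$ through $\mathrm{SO}_0(2,n)\subset\mathrm{SO}_0(2,n+1)$.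 A photon is the set of rays contained in a totally isotropic $2$-plane. A sequence $(g_k)$ acting on $\mathrm{Ein}_{n+1}$ has balanced distortion if there are photons $\Delta^+,\Delta^-$ and continuous maps $\pi_+:\mathrm{Ein}_{n+1}\setminus\Delta^-\to\Delta^+$, $\pi_-:\mathrm{Ein}_{n+1}\setminus\Delta^+\to\Delta^-$ such that each fiber of $\pi_+$ over a point of $\Delta^+$ (resp. of $\pi_-$ over a point of $\Delta^-$) is of the form $C^-(x)\setminus\Delta^-$ with $x\in\Delta^-$ (resp. $C^-(x)\setminus\Delta^+$ with $x\in\Delta^+$), where $C^-(x)$ is the past lightcone of $x$ (the union of the past-oriented lightlike geodesic segments from $x$ to $-x$), and such that $g_k\to\pi_+$ uniformly on compact subsets of $\mathrm{Ein}_{n+1}\setminus\Delta^-$ and $g_k^{-1}\to\pi_-$ uniformly on compact subsets of $\mathrm{Ein}_{n+1}\setminus\Delta^+$. Points $x^+,x^-\in\mathrm{Ein}_{n+1}$ are attracting and repelling poles of $(g_k)$ if $\langle x^+,x^-\rangle\le 0$; $g_k$ converges to the constant $x^+$ (resp. $-x^+$) uniformly on compact subsets of $\{x:\langle x,x^-\rangle<0\}$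 (resp. $\{x:\langle x,x^-\rangle>0\}$); and $g_k^{-1}$ converges to the constant $x^-$ (resp. $-x^-$) uniformly on compact subsets of $\{x:\langle x,x^+\rangle<0\}$ (resp. $\{x:\langle x,x^+\rangle>0\}$). Then: 1. for no sequence $(\gamma_k)$ in $\Gamma$ does $(\rho(\gamma_k))$ have balanced distortion; 2. for every sequence $(\gamma_k)$ in $\Gamma$ that leaves every finite subset of $\Gamma$, there is a subsequence $(\gamma_{k_j})$ such that $(\rho(\gamma_{k_j}))$ has an attracting pole $x^+$ and a repelling pole $x^-$ with $x^+,x^-\in\Lambda_\rho$. -/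

import Mathlib

open Filter Topology Set

noncomputable section

namespace EinAdS

/-! ### The quadratic space of signature `(2,n)` and its special orthogonal group -/

/-- The vector space underlying `ℝ^{2,n}`: two negative coordinates, then `n` positive ones. -/
abbrev V (n : ℕ) : Type := Fin 2 ⊕ Fin n → ℝ

/-- The symmetric bilinear form `⟨v, w⟩ = - u₁u₁' - u₂u₂' + x₁x₁' + ⋯ + xₙxₙ'`. -/
def form {n : ℕ} (v w : V n) : ℝ :=
  -(∑ i : Fin 2, v (Sum.inl i) * w (Sum.inl i)) + ∑ j : Fin n, v (Sum.inr j) * w (Sum.inr j)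

/-- `SO(2,n)`, with the topology of invertible matrices. -/
def SO (n : ℕ) : Subgroup (GL (Fin 2 ⊕ Fin n) ℝ) where
  carrier := {g | (∀ v w : V n, form (g.1.mulVec v) (g.1.mulVec w) = form v w) ∧ g.1.det = 1}
  mul_mem' := by
    rintro a b ⟨ha, ha'⟩ ⟨hb, hb'⟩
    refine ⟨fun v w => ?_, ?_⟩
    · rw [Units.val_mul, ← Matrix.mulVec_mulVec, ← Matrix.mulVec_mulVec, ha, hb]
    · rw [Units.val_mul, Matrix.det_mul, ha', hb', one_mul]
  one_mem' := by simp
  inv_mem' := by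
    rintro a ⟨ha, ha'⟩
    have key : ∀ v : V n, a.1.mulVec ((a⁻¹).1.mulVec v) = v := fun v => by
      rw [Matrix.mulVec_mulVec, ← Units.val_mul, mul_inv_cancel, Units.val_one, Matrix.one_mulVec]
    refine ⟨fun v w => ?_, ?_⟩
    · rw [← ha, key, key]
    · have h : (a.1 * (a⁻¹).1).det = 1 := by
        rw [← Units.val_mul, mul_inv_cancel, Units.val_one, Matrix.det_one]
      rwa [Matrix.det_mul, ha', one_mul] at h

/-- `SO₀(2,n)`: the identity component of `SO(2,n)`. -/
def SO₀ (n : ℕ) : Subgroup (SO n) := Subgroup.connectedComponentOfOne (SO n)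

/-! ### The Einstein universe (double cover) -/

/-- The Einstein universe of dimension `n`: the space of rays of the cone of nonzero isotropic
vectors of `ℝ^{2,n}`. Each such ray is represented by its unique vector whose negative part and
positive part both have Euclidean norm one, so this is `S¹ × Sⁿ⁻¹`. -/
def Ein (n : ℕ) : Type :=
  {v : V n // ∑ i : Fin 2, v (Sum.inl i) ^ 2 = 1 ∧ ∑ j : Fin n, v (Sum.inr j) ^ 2 = 1}

instance (n : ℕ) : MetricSpace (Ein n) := inferInstanceAs (MetricSpace (Subtype _))

/-- The antipodal map, sending a ray to the opposite ray. -/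
instance (n : ℕ) : Neg (Ein n) where
  neg x := ⟨-x.1, by simpa using x.2⟩

/-- The Euclidean norm of the negative part. -/
def negNorm {n : ℕ} (v : V n) : ℝ := Real.sqrt (∑ i : Fin 2, v (Sum.inl i) ^ 2)

theorem form_self {n : ℕ} (v : V n) :
    form v v = -(∑ i : Fin 2, v (Sum.inl i) ^ 2) + ∑ j : Fin n, v (Sum.inr j) ^ 2 := by
  simp only [form, pow_two]

theorem Ein.val_ne_zero {n : ℕ} (x : Ein n) : x.1 ≠ 0 := by
  intro h
  have := x.2.1
  simp [h] at this

theorem form_image {n : ℕ} (g : SO n) (x : Ein n) :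
    form (g.1.1.mulVec x.1) (g.1.1.mulVec x.1) = 0 := by
  rw [g.2.1, form_self, x.2.1, x.2.2]; norm_num

theorem image_ne_zero {n : ℕ} (g : SO n) (x : Ein n) : g.1.1.mulVec x.1 ≠ 0 := by
  intro h
  apply x.val_ne_zero
  have : (g.1⁻¹).1.mulVec (g.1.1.mulVec x.1) = x.1 := by
    rw [Matrix.mulVec_mulVec, ← Units.val_mul, inv_mul_cancel, Units.val_one, Matrix.one_mulVec]
  rw [← this, h, Matrix.mulVec_zero]

theorem sum_sq_pos_of_isotropic {n : ℕ} (v : V n) (h0 : v ≠ 0) (h : form v v = 0) :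
    0 < ∑ i : Fin 2, v (Sum.inl i) ^ 2 := by
  rw [form_self] at h
  refine lt_of_le_of_ne (Finset.sum_nonneg fun i _ => sq_nonneg _) fun h1 => h0 ?_
  have h2 : ∑ j : Fin n, v (Sum.inr j) ^ 2 = 0 := by linarith
  have a1 := (Finset.sum_eq_zero_iff_of_nonneg (fun i _ => sq_nonneg (v (Sum.inl i)))).1 h1.symm
  have a2 := (Finset.sum_eq_zero_iff_of_nonneg (fun j _ => sq_nonneg (v (Sum.inr j)))).1 h2
  funext k
  rcases k with i | j
  · exact pow_eq_zero_iff (two_ne_zero) |>.1 (a1 i (Finset.mem_univ _))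
  · exact pow_eq_zero_iff (two_ne_zero) |>.1 (a2 j (Finset.mem_univ _))

/-- The action of `SO(2,n)` on rays: apply the matrix and renormalize by a positive factor. -/
def act {n : ℕ} (g : SO n) (x : Ein n) : Ein n :=
  ⟨(negNorm (g.1.1.mulVec x.1))⁻¹ • g.1.1.mulVec x.1, by
    have hp := sum_sq_pos_of_isotropic _ (image_ne_zero g x) (form_image g x)
    have hq := form_image g x
    rw [form_self] at hq
    have hs : (negNorm (g.1.1.mulVec x.1))⁻¹ ^ 2
        = (∑ i : Fin 2, (g.1.1.mulVec x.1) (Sum.inl i) ^ 2)⁻¹ := by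
      rw [inv_pow, negNorm, Real.sq_sqrt hp.le]
    constructor
    · simp only [Pi.smul_apply, smul_eq_mul, mul_pow, hs, ← Finset.mul_sum]
      exact inv_mul_cancel₀ hp.ne'
    · simp only [Pi.smul_apply, smul_eq_mul, mul_pow, hs, ← Finset.mul_sum]
      rw [inv_mul_eq_one₀ hp.ne']
      linarith⟩

/-! ### The inclusions `SO(2,n) ⊂ SO(2,n+1)` and `Ein_n ⊂ Ein_{n+1}` -/

/-- The index bijection singling out the last positive coordinate of `ℝ^{2,n+1}`. -/
def splitLast (n : ℕ) : (Fin 2 ⊕ Fin n) ⊕ Fin 1 ≃ Fin 2 ⊕ Fin (n + 1) :=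
  (Equiv.sumAssoc _ _ _).trans (Equiv.sumCongr (Equiv.refl _) finSumFinEquiv)

theorem form_splitLast {n : ℕ} (v w : V (n + 1)) :
    form v w = form (fun k => v (splitLast n (Sum.inl k))) (fun k => w (splitLast n (Sum.inl k)))
      + v (splitLast n (Sum.inr 0)) * w (splitLast n (Sum.inr 0)) := by
  have h1 : ∀ i : Fin 2, splitLast n (Sum.inl (Sum.inl i)) = Sum.inl i := fun _ => rfl
  have h2 : ∀ j : Fin n, splitLast n (Sum.inl (Sum.inr j)) = Sum.inr j.castSucc := fun _ => rfl
  have h3 : splitLast n (Sum.inr 0) = Sum.inr (Fin.last n) := rfl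
  simp only [form, h1, h2, h3, Fin.sum_univ_castSucc (n := n)]
  ring

/-- The block matrix `diag(A, 1)`, acting as `A` on the first `n+2` coordinates of `ℝ^{2,n+1}` and
fixing the last coordinate. -/
def extMatrix (n : ℕ) :
    Matrix (Fin 2 ⊕ Fin n) (Fin 2 ⊕ Fin n) ℝ →*
      Matrix (Fin 2 ⊕ Fin (n + 1)) (Fin 2 ⊕ Fin (n + 1)) ℝ where
  toFun A := Matrix.reindex (splitLast n) (splitLast n) (Matrix.fromBlocks A 0 0 1)
  map_one' := by simp [Matrix.fromBlocks_one]
  map_mul' A B := by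
    simp only [Matrix.reindex_apply, Matrix.submatrix_mul_equiv, Matrix.fromBlocks_multiply]
    simp

theorem extMatrix_mulVec_inl {n : ℕ} (A : Matrix (Fin 2 ⊕ Fin n) (Fin 2 ⊕ Fin n) ℝ)
    (v : V (n + 1)) (k : Fin 2 ⊕ Fin n) :
    (extMatrix n A).mulVec v (splitLast n (Sum.inl k))
      = A.mulVec (fun l => v (splitLast n (Sum.inl l))) k := by
  simp only [Matrix.mulVec, dotProduct, extMatrix, MonoidHom.coe_mk, OneHom.coe_mk,
    Matrix.reindex_apply, Matrix.submatrix_apply, Equiv.symm_apply_apply]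
  rw [← Equiv.sum_comp (splitLast n)]
  simp [Fintype.sum_sum_type]

theorem extMatrix_mulVec_inr {n : ℕ} (A : Matrix (Fin 2 ⊕ Fin n) (Fin 2 ⊕ Fin n) ℝ)
    (v : V (n + 1)) :
    (extMatrix n A).mulVec v (splitLast n (Sum.inr 0)) = v (splitLast n (Sum.inr 0)) := by
  simp only [Matrix.mulVec, dotProduct, extMatrix, MonoidHom.coe_mk, OneHom.coe_mk,
    Matrix.reindex_apply, Matrix.submatrix_apply, Equiv.symm_apply_apply]
  rw [← Equiv.sum_comp (splitLast n)]
  simp [Fintype.sum_sum_type]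

/-- The inclusion `SO(2,n) ⊂ SO(2,n+1)`. -/
def incl (n : ℕ) : SO n →* SO (n + 1) :=
  ((Units.map (extMatrix n)).comp (SO n).subtype).codRestrict (SO (n + 1)) (by
    intro g
    refine ⟨fun v w => ?_, ?_⟩
    · change form ((extMatrix n g.1.1).mulVec v) ((extMatrix n g.1.1).mulVec w) = form v w
      rw [form_splitLast, form_splitLast v w]
      simp only [extMatrix_mulVec_inl, extMatrix_mulVec_inr]
      exact congrArg (· + _) (g.2.1 _ _)
    · change (extMatrix n g.1.1).det = 1
      simp [extMatrix, g.2.2])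

/-- The inclusion `Ein_n ⊂ Ein_{n+1}`, appending a zero coordinate. -/
def emb {n : ℕ} (x : Ein n) : Ein (n + 1) :=
  ⟨fun k => Sum.elim x.1 (fun _ => 0) ((splitLast n).symm k), by
    have h1 : ∀ i : Fin 2, (splitLast n).symm (Sum.inl i) = Sum.inl (Sum.inl i) := fun _ => rfl
    have h2 : ∀ j : Fin n, (splitLast n).symm (Sum.inr j.castSucc) = Sum.inl (Sum.inr j) :=
      fun j => (Equiv.symm_apply_eq _).2 rfl
    have h3 : (splitLast n).symm (Sum.inr (Fin.last n)) = Sum.inr 0 :=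
      (Equiv.symm_apply_eq _).2 rfl
    simp only [Fin.sum_univ_castSucc (n := n), h1, h2, h3, Sum.elim_inl, Sum.elim_inr]
    simpa using x.2⟩

/-! ### Causality: achronal and acausal subsets of the Einstein universe -/

/-- The cover `ℝ × Sⁿ⁻¹` of the Einstein universe `S¹ × Sⁿ⁻¹`; it carries the conformal class of
the Lorentzian metric `-dθ² + ds²`, time-oriented by `θ`. -/
abbrev EinCover (n : ℕ) : Type := ℝ × Metric.sphere (0 : EuclideanSpace ℝ (Fin n)) 1

/-- The covering projection `(θ, z) ↦ (cos θ, sin θ, z)`. -/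
def proj {n : ℕ} (p : EinCover n) : Ein n :=
  ⟨Sum.elim ![Real.cos p.1, Real.sin p.1] (fun j => p.2.1 j), by
    have h := p.2.2
    rw [mem_sphere_zero_iff_norm, EuclideanSpace.norm_eq, Real.sqrt_eq_one] at h
    simpa [Fin.sum_univ_two] using h⟩

/-- `(θ, z)`, restricted to `[0,1]`, is a `C¹` future-oriented timelike curve from `p` to `q` for
`-dθ² + ds²` on `ℝ × Sⁿ⁻¹`. -/
def IsTimelikeCurve {n : ℕ} (θ : ℝ → ℝ) (z : ℝ → EuclideanSpace ℝ (Fin n))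
    (p q : EinCover n) : Prop :=
  ContDiffOn ℝ 1 θ (Icc 0 1) ∧ ContDiffOn ℝ 1 z (Icc 0 1) ∧ (∀ t ∈ Icc (0 : ℝ) 1, ‖z t‖ = 1) ∧
    (∀ t ∈ Icc (0 : ℝ) 1, ‖derivWithin z (Icc 0 1) t‖ < derivWithin θ (Icc 0 1) t) ∧
    (θ 0 = p.1 ∧ z 0 = p.2.1) ∧ (θ 1 = q.1 ∧ z 1 = q.2.1)

/-- `(θ, z)`, restricted to `[0,1]`, is a `C¹` future-oriented causal curve from `p` to `q`: its
velocity is everywhere nonzero, future-oriented, and timelike or lightlike. -/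
def IsCausalCurve {n : ℕ} (θ : ℝ → ℝ) (z : ℝ → EuclideanSpace ℝ (Fin n))
    (p q : EinCover n) : Prop :=
  ContDiffOn ℝ 1 θ (Icc 0 1) ∧ ContDiffOn ℝ 1 z (Icc 0 1) ∧ (∀ t ∈ Icc (0 : ℝ) 1, ‖z t‖ = 1) ∧
    (∀ t ∈ Icc (0 : ℝ) 1, 0 < derivWithin θ (Icc 0 1) t ∧
      ‖derivWithin z (Icc 0 1) t‖ ≤ derivWithin θ (Icc 0 1) t) ∧
    (θ 0 = p.1 ∧ z 0 = p.2.1) ∧ (θ 1 = q.1 ∧ z 1 = q.2.1)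

/-- A subset of `Ein_n` is achronal if it is the projection of a subset of `ℝ × Sⁿ⁻¹` no two points
of which are joined by a timelike curve. -/
def IsAchronal {n : ℕ} (Λ : Set (Ein n)) : Prop :=
  ∃ S : Set (EinCover n), proj '' S = Λ ∧
    ∀ p ∈ S, ∀ q ∈ S, p ≠ q → ¬ ∃ θ z, IsTimelikeCurve θ z p q

/-- A subset of `Ein_n` is acausal if it is the projection of a subset of `ℝ × Sⁿ⁻¹` no two
distinct points of which are joined by a causal curve. -/
def IsAcausal {n : ℕ} (Λ : Set (Ein n)) : Prop :=
  ∃ S : Set (EinCover n), proj '' S = Λ ∧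
    ∀ p ∈ S, ∀ q ∈ S, p ≠ q → ¬ ∃ θ z, IsCausalCurve θ z p q

/-- `ρ` is GHC-regular with limit set `Λ`: it is faithful, has discrete image, and preserves the
achronal topological `(n-1)`-sphere `Λ` of `Ein_n`. -/
structure IsGHCRegular {n : ℕ} {Γ : Type*} [Group Γ] (ρ : Γ →* SO₀ n) (Λ : Set (Ein n)) :
    Prop where
  faithful : Function.Injective ρ
  discrete : DiscreteTopology ρ.range
  invariant : ∀ γ : Γ, act (ρ γ).1 '' Λ = Λ
  achronal : IsAchronal Λ
  sphere : Nonempty (Λ ≃ₜ Metric.sphere (0 : EuclideanSpace ℝ (Fin n)) 1)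

/-! ### Balanced and unbalanced distortion -/

/-- A photon (unparametrized lightlike geodesic) of `Ein_m`: the set of rays contained in a totally
isotropic 2-plane. -/
def IsPhoton {m : ℕ} (Δ : Set (Ein m)) : Prop :=
  ∃ P : Submodule ℝ (V m), Module.finrank ℝ P = 2 ∧ (∀ v ∈ P, form v v = 0) ∧
    Δ = {x | x.1 ∈ P}

/-- The past lightcone `C⁻(x)`: the union of the past-oriented lightlike geodesics
`t ↦ (cos (θ - t), sin (θ - t), cos t • z + sin t • e)`, `0 ≤ t ≤ π`, going from
`x = (cos θ, sin θ, z)` to its antipode `-x`, where `e` is a unit vector tangent to the sphere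
at `z`. -/
def pastCone {m : ℕ} (x : Ein m) : Set (Ein m) :=
  {y | ∃ (θ : ℝ) (z : Metric.sphere (0 : EuclideanSpace ℝ (Fin m)) 1)
      (e : Metric.sphere (0 : EuclideanSpace ℝ (Fin m)) 1) (t : ℝ),
    x = proj (θ, z) ∧ inner ℝ z.1 e.1 = 0 ∧ t ∈ Icc 0 Real.pi ∧
    y.1 = Sum.elim ![Real.cos (θ - t), Real.sin (θ - t)]
      (fun j => Real.cos t * z.1 j + Real.sin t * e.1 j)}

/-- One half of the balanced dynamics: outside the photon `Δ⁻` the sequence `g` converges, uniformly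
on compact sets, to a continuous map onto the photon `Δ⁺` whose fibers are past lightcones of points
of `Δ⁻` (deprived of `Δ⁻`, where the map is not defined). -/
def ConvergesToPhoton {m : ℕ} (g : ℕ → SO m) (Δplus Δminus : Set (Ein m)) : Prop :=
  ∃ π : Ein m → Ein m, ContinuousOn π Δminusᶜ ∧ MapsTo π Δminusᶜ Δplus ∧
    (∀ p ∈ Δplus, ∃ x ∈ Δminus, {y | y ∈ Δminusᶜ ∧ π y = p} = pastCone x \ Δminus) ∧
    ∀ K : Set (Ein m), IsCompact K → K ⊆ Δminusᶜ →
      TendstoUniformlyOn (fun k => act (g k)) π atTop K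

/-- The sequence `g` has balanced distortion, with some attracting and repelling photons. -/
def HasBalancedDistortion {m : ℕ} (g : ℕ → SO m) : Prop :=
  ∃ Δplus Δminus : Set (Ein m), IsPhoton Δplus ∧ IsPhoton Δminus ∧
    ConvergesToPhoton g Δplus Δminus ∧ ConvergesToPhoton (fun k => (g k)⁻¹) Δminus Δplus

/-- One half of the unbalanced dynamics: `g` converges to the constant `x⁺` uniformly on compact
subsets of `{y | ⟨y, x⁻⟩ < 0}`, and to the opposite point of `x⁺` uniformly on compact subsets of
`{y | ⟨y, x⁻⟩ > 0}`. -/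
def ConvergesToPole {m : ℕ} (g : ℕ → SO m) (xplus xminus : Ein m) : Prop :=
  (∀ K : Set (Ein m), IsCompact K → K ⊆ {y | form y.1 xminus.1 < 0} →
      TendstoUniformlyOn (fun k => act (g k)) (fun _ => xplus) atTop K) ∧
    ∀ K : Set (Ein m), IsCompact K → K ⊆ {y | 0 < form y.1 xminus.1} →
      TendstoUniformlyOn (fun k => act (g k)) (fun _ => -xplus) atTop K

/-- `x⁺` and `x⁻` form a pair of attracting and repelling poles of the sequence `g`, which then
has unbalanced distortion. -/
def IsPolePair {m : ℕ} (g : ℕ → SO m) (xplus xminus : Ein m) : Prop :=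
  form xplus.1 xminus.1 ≤ 0 ∧ ConvergesToPole g xplus xminus ∧
    ConvergesToPole (fun k => (g k)⁻¹) xminus xplus

end EinAdS

end

noncomputable section

namespace EinAdS

/-! ### Brouwer's theorem, and images of balls under continuous injections -/

/-! Acausality makes `form x y` strictly negative for distinct `x, y ∈ Λ` (`form_neg_of_isAcausal`).
The other geometric input is that `Λ` lies in no degenerate hyperplane `q^⊥` with `q` isotropic
(`exists_form_ne_zero`): inside `q^⊥`, negativity would let `Λ` project injectively to a sphere of
dimension `n - 2`, which is impossible for a sphere of dimension `n - 1`.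

Let `γ k` leave every finite set. By discreteness the matrix norms of `g k = ρ (γ k)` tend to
infinity, so after passing to a subsequence the normalized matrices converge to some `M ≠ 0`, and
both `M` and its adjoint for the form have totally isotropic image. Wherever `M` does not vanish on
`Λ`, it gives the limit of the action, which stays in `Λ` because `Λ` is closed and invariant. Two
such limits are orthogonal, hence equal by negativity, so `M` sends all of `Λ` into one line `ℝ p`.
If `w ⊥ p`, the isotropic vector `adj M w` is orthogonal to `Λ`, hence zero. So `M` has rank one, `M
v = c ⟨v, x⁻⟩ x⁺` with `c < 0` and `x⁺, x⁻ ∈ Λ` (`exists_rank_one_limit`). In `ℝ^{2,n+1}` the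
additional coordinate is killed by the rescaling, the limit keeps this shape, and it is exactly the
pole dynamics.

For the first claim, a sequence in `Γ` has a subsequence that is constant or leaves every finite
set. A constant one would make the limit map injective off the photon, although its fibers contain
most of a lightcone. In the other case the limit map takes only the values `±x⁺` on a dense set,
while by continuity it must reach other points of the photon `Δ⁺`.

The dimension statement about spheres is derived from a Brouwer-type surjectivity theorem
(`surjective_id_add`), proved by a polynomial-in-`t` change of variables. -/

theorem exists_polynomial_det_one_add_smul {E : Type*} [NormedAddCommGroup E]
    [NormedSpace ℝ E] [FiniteDimensional ℝ E] (A : E →L[ℝ] E) :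
    ∃ p : Polynomial ℝ, p.natDegree ≤ Module.finrank ℝ E ∧
      ∀ t : ℝ, p.eval t = (ContinuousLinearMap.id ℝ E + t • A).det := by
  classical
  let b := Module.finBasis ℝ E
  let M := LinearMap.toMatrix b b (A : E →ₗ[ℝ] E)
  refine ⟨((Polynomial.X : Polynomial ℝ) • M.map Polynomial.C
    + (1 : Matrix _ _ ℝ).map Polynomial.C).det, ?_, fun t => ?_⟩
  · simpa using Polynomial.natDegree_det_X_add_C_le M 1
  · rw [← Polynomial.coe_evalRingHom, RingHom.map_det]
    have h : LinearMap.toMatrix b b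
        ((ContinuousLinearMap.id ℝ E + t • A : E →L[ℝ] E) : E →ₗ[ℝ] E) = t • M + 1 := by
      rw [add_comm]
      simp [M]
    rw [ContinuousLinearMap.det, ← LinearMap.det_toMatrix b, h]
    congr 1
    ext i j
    simp only [Polynomial.coe_evalRingHom, RingHom.mapMatrix_apply, Matrix.map_apply,
      Matrix.add_apply, Matrix.smul_apply, smul_eq_mul, Polynomial.eval_add, Polynomial.eval_mul,
      Polynomial.eval_X, Polynomial.eval_C]

/-- Lagrange interpolation recovers the value at `1` from nodes in `(0, t₀)`, with weights
independent of the polynomial. An identity known only for small `t` can thus be carried to `t = 1`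
under an integral sign, without integrating coefficients. -/
theorem exists_interpolation_nodes (D : ℕ) {t₀ : ℝ} (ht₀ : 0 < t₀) :
    ∃ c τ : ℕ → ℝ, (∀ i, 0 < τ i ∧ τ i < t₀) ∧ ∀ p : Polynomial ℝ, p.natDegree ≤ D →
      p.eval 1 = ∑ i ∈ Finset.range (D + 1), c i * p.eval (τ i) := by
  let τ : ℕ → ℝ := fun i => t₀ / (i + 2)
  have hinj : Function.Injective τ := by
    intro i j h
    have hi : (0 : ℝ) < i + 2 := by positivity
    have hj : (0 : ℝ) < j + 2 := by positivity
    simp only [τ] at h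
    rw [div_eq_div_iff hi.ne' hj.ne'] at h
    have := mul_left_cancel₀ ht₀.ne' h
    exact_mod_cast (by linarith : (i : ℝ) = j)
  refine ⟨fun i => (Lagrange.basis (Finset.range (D + 1)) τ i).eval 1, τ, fun i => ⟨?_, ?_⟩,
    fun p hp => ?_⟩
  · positivity
  · apply div_lt_self ht₀
    have : (0 : ℝ) ≤ i := by positivity
    linarith
  · have hd : p.degree < (Finset.range (D + 1)).card := by
      rw [Finset.card_range]
      refine (Polynomial.degree_le_of_natDegree_le hp).trans_lt ?_
      exact_mod_cast Nat.lt_succ_self D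
    conv_lhs => rw [Lagrange.eq_interpolate (v := τ) hinj.injOn hd]
    simp [Lagrange.interpolate_apply, Polynomial.eval_finsetSum, mul_comm]

/-- Along `s ∈ [0, 1]` the map `1 + s A` has trivial kernel, so its determinant never vanishes and
keeps the sign it has at `s = 0`. -/
theorem det_one_add_pos {E : Type*} [NormedAddCommGroup E] [NormedSpace ℝ E]
    [FiniteDimensional ℝ E] {A : E →L[ℝ] E} (hA : ‖A‖ < 1) :
    0 < (ContinuousLinearMap.id ℝ E + A).det := by
  obtain ⟨p, -, hp⟩ := exists_polynomial_det_one_add_smul A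
  have hne : ∀ s ∈ Icc (0 : ℝ) 1, p.eval s ≠ 0 := by
    intro s hs h0
    rw [hp] at h0
    have hker : LinearMap.ker
        ((ContinuousLinearMap.id ℝ E + s • A : E →L[ℝ] E) : E →ₗ[ℝ] E) ≠ ⊥ :=
      (LinearMap.bot_lt_ker_of_det_eq_zero h0).ne'
    apply hker
    rw [Submodule.eq_bot_iff]
    intro v hv
    have hv' : v + s • A v = 0 := by simpa using hv
    by_contra hv0
    have h1 : ‖v‖ = ‖s • A v‖ := by
      conv_lhs => rw [eq_neg_of_add_eq_zero_left hv', norm_neg]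
    have h2 : ‖s • A v‖ ≤ ‖A v‖ := by
      rw [norm_smul, Real.norm_of_nonneg hs.1]
      exact mul_le_of_le_one_left (norm_nonneg _) hs.2
    have h3 := A.le_opNorm v
    have h4 : ‖A‖ * ‖v‖ < 1 * ‖v‖ := mul_lt_mul_of_pos_right hA (norm_pos_iff.2 hv0)
    linarith
  have h0 : p.eval 0 = 1 := by rw [hp]; simp [ContinuousLinearMap.det]
  have h1 : p.eval 1 = (ContinuousLinearMap.id ℝ E + A).det := by rw [hp, one_smul]
  rw [← h1]
  by_contra hcon
  obtain ⟨s, hs, hs0⟩ := intermediate_value_Icc' (zero_le_one' ℝ) p.continuous.continuousOn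
    (show (0 : ℝ) ∈ Icc (p.eval 1) (p.eval 0) from ⟨not_lt.1 hcon, by rw [h0]; exact zero_le_one⟩)
  exact hne s hs hs0

theorem continuous_det_id_add_fderiv {E : Type*} [NormedAddCommGroup E] [NormedSpace ℝ E]
    {u : E → E} (hu : ContDiff ℝ 1 u) :
    Continuous fun x => (ContinuousLinearMap.id ℝ E + fderiv ℝ u x).det :=
  ContinuousLinearMap.continuous_det.comp
    (continuous_const.add (hu.continuous_fderiv one_ne_zero))

section Volume

open MeasureTheory

variable {E : Type*} [NormedAddCommGroup E] [InnerProductSpace ℝ E] [FiniteDimensional ℝ E]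

theorem bijective_id_add {u : E → E} {K : NNReal} (hu : LipschitzWith K u) (hK : K < 1) :
    Function.Bijective fun x => x + u x := by
  have happ : ApproximatesLinearOn (fun x => x + u x)
      ((ContinuousLinearEquiv.refl ℝ E : E ≃L[ℝ] E) : E →L[ℝ] E) univ K := by
    intro x _ y _
    have := hu.dist_le_mul x y
    rw [dist_eq_norm, dist_eq_norm] at this
    have h : x + u x - (y + u y) - (x - y) = u x - u y := by abel
    change ‖x + u x - (y + u y) - (x - y)‖ ≤ K * ‖x - y‖
    rwa [h]
  have hc : Subsingleton E ∨
      K < ‖((ContinuousLinearEquiv.refl ℝ E).symm : E →L[ℝ] E)‖₊⁻¹ := by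
    rcases subsingleton_or_nontrivial E with h | h
    · exact Or.inl h
    · right
      have : ‖((ContinuousLinearEquiv.refl ℝ E).symm : E →L[ℝ] E)‖₊ = 1 := by
        ext
        exact ContinuousLinearMap.norm_id
      rw [this, inv_one]
      exact hK
  exact ⟨injOn_univ.1 (happ.injOn hc), happ.surjective hc⟩

variable [MeasurableSpace E] [BorelSpace E]

/-- Being a bijection that fixes every point outside `B`, the map `x + u x` permutes `B`. Change of
variables applies, and the Jacobian is positive, so no absolute value is needed. -/
theorem setIntegral_det_mul_comp_of_lipschitz {u : E → E} (hu : ContDiff ℝ 1 u) {K : NNReal}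
    (hK : LipschitzWith K u) (hK1 : K < 1) {B : Set E} (hB : MeasurableSet B)
    (hB0 : ∀ x ∉ B, u x = 0) (w : E → ℝ) :
    ∫ x in B, (ContinuousLinearMap.id ℝ E + fderiv ℝ u x).det * w (x + u x) = ∫ x in B, w x := by
  have hbij := bijective_id_add hK hK1
  have himg : (fun x => x + u x) '' B = B := by
    have hcompl : (fun x => x + u x) '' Bᶜ = Bᶜ := by
      have : EqOn (fun x => x + u x) id Bᶜ := fun x hx => by simp [hB0 x hx]
      rw [this.image_eq, image_id]
    rw [← compl_inj_iff, ← image_compl_eq hbij, hcompl]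
  have hder : ∀ x ∈ B, HasFDerivWithinAt (fun x => x + u x)
      (ContinuousLinearMap.id ℝ E + fderiv ℝ u x) B x := fun x _ =>
    ((hasFDerivAt_id x).add
      (hu.differentiable one_ne_zero x).hasFDerivAt).hasFDerivWithinAt
  have key := integral_image_eq_integral_abs_det_fderiv_smul volume hB hder hbij.1.injOn w
  rw [himg] at key
  rw [key]
  refine integral_congr_ae (Eventually.of_forall fun x => ?_)
  have hpos : 0 < (ContinuousLinearMap.id ℝ E + fderiv ℝ u x).det :=
    det_one_add_pos ((norm_fderiv_le_of_lipschitz ℝ hK).trans_lt (by exact_mod_cast hK1))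
  simp only [abs_of_pos hpos, smul_eq_mul]

/-- For fixed `x` the integrand of `x + t u x` is a polynomial in `t`, of degree at most the
dimension plus `2 N`. The integral is constant for small `t`, where `t u` is a contraction, hence it
has the same value at `t = 1`. -/
theorem setIntegral_det_mul_weight {u : E → E} (hu : ContDiff ℝ 1 u) (hc : HasCompactSupport u)
    (y : E) {R : ℝ} (hR : ∀ x ∉ Metric.closedBall y R, u x = 0) (N : ℕ) :
    ∫ x in Metric.closedBall y R, (ContinuousLinearMap.id ℝ E + fderiv ℝ u x).det *
        (R ^ 2 - ‖x + u x - y‖ ^ 2) ^ N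
      = ∫ x in Metric.closedBall y R, (R ^ 2 - ‖x - y‖ ^ 2) ^ N := by
  obtain ⟨K, hK⟩ := hu.lipschitzWith_of_hasCompactSupport hc one_ne_zero
  set D := Module.finrank ℝ E + 2 * N with hD
  obtain ⟨c, τ, hτ, hint⟩ := exists_interpolation_nodes D
    -- Nodes below `1 / (K + 1)` make `τ i • u` Lipschitz with constant less than one.
    (show (0 : ℝ) < 1 / (K + 1) by positivity)
  let F : ℝ → E → ℝ := fun t x => (ContinuousLinearMap.id ℝ E + t • fderiv ℝ u x).det *
        (R ^ 2 - ‖x + t • u x - y‖ ^ 2) ^ N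
  have hpoly : ∀ x, ∃ p : Polynomial ℝ, p.natDegree ≤ D ∧ ∀ t, p.eval t = F t x := by
    intro x
    obtain ⟨p, hp, hp'⟩ := exists_polynomial_det_one_add_smul (fderiv ℝ u x)
    let q : Polynomial ℝ := Polynomial.C (R ^ 2 - ‖x - y‖ ^ 2)
      + Polynomial.C (-2 * inner ℝ (x - y) (u x)) * Polynomial.X
      + Polynomial.C (-‖u x‖ ^ 2) * Polynomial.X ^ 2
    have hq : q.natDegree ≤ 2 := by
      simp only [q]
      compute_degree
    refine ⟨p * q ^ N, ?_, fun t => ?_⟩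
    · refine Polynomial.natDegree_mul_le.trans ?_
      have := Polynomial.natDegree_pow_le_of_le N hq
      omega
    · have : x + t • u x - y = (x - y) + t • u x := by abel
      simp only [F, Polynomial.eval_mul, hp', Polynomial.eval_pow, q, this, norm_add_sq_real,
        Polynomial.eval_add, Polynomial.eval_C, Polynomial.eval_X, norm_smul, inner_smul_right,
        mul_pow, Real.norm_eq_abs, sq_abs]
      ring
  have hone : ∀ x, F 1 x = ∑ i ∈ Finset.range (D + 1), c i * F (τ i) x := by
    intro x
    obtain ⟨p, hp, hp'⟩ := hpoly x
    simpa only [hp'] using hint p hp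
  have hcont : ∀ t, Continuous (F t) := by
    intro t
    have h1 : Continuous fun x => (ContinuousLinearMap.id ℝ E + t • fderiv ℝ u x).det :=
      ContinuousLinearMap.continuous_det.comp
        (continuous_const.add ((hu.continuous_fderiv one_ne_zero).const_smul t))
    have h2 := hu.continuous
    fun_prop
  have hsmall : ∀ i, ∫ x in Metric.closedBall y R, F (τ i) x
      = ∫ x in Metric.closedBall y R, (R ^ 2 - ‖x - y‖ ^ 2) ^ N := by
    intro i
    have hτK : ‖τ i‖₊ * K < 1 := by
      rw [← NNReal.coe_lt_coe]
      simp only [NNReal.coe_mul, coe_nnnorm, NNReal.coe_one, Real.norm_of_nonneg (hτ i).1.le]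
      have h1 := (hτ i).2
      rw [lt_div_iff₀ (by positivity)] at h1
      nlinarith [(hτ i).1]
    have hlip : LipschitzWith (‖τ i‖₊ * K) (τ i • u) := by
      simpa using! (lipschitzWith_smul (τ i)).comp hK
    have := setIntegral_det_mul_comp_of_lipschitz (hu.const_smul (τ i)) hlip hτK
      (B := Metric.closedBall y R) Metric.isClosed_closedBall.measurableSet
      (fun x hx => by simp [hR x hx]) (fun x => (R ^ 2 - ‖x - y‖ ^ 2) ^ N)
    rw [← this]
    refine integral_congr_ae (Eventually.of_forall fun x => ?_)
    have hfd : fderiv ℝ (fun z => τ i • u z) x = τ i • fderiv ℝ u x :=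
      fderiv_const_smul (hu.differentiable one_ne_zero x) (τ i)
    simp only [F, hfd]
  have hsum : ∑ i ∈ Finset.range (D + 1), c i = 1 := by
    simpa using (hint 1 (by simp)).symm
  have hF1 : ∀ x, (ContinuousLinearMap.id ℝ E + fderiv ℝ u x).det *
        (R ^ 2 - ‖x + u x - y‖ ^ 2) ^ N = F 1 x := fun x => by simp only [F, one_smul]
  simp only [hF1, hone]
  rw [integral_finsetSum _ fun i _ => ((hcont (τ i)).continuousOn.integrableOn_compact
    (isCompact_closedBall y R)).const_mul (c i)]
  simp only [integral_const_mul, hsmall]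
  rw [← Finset.sum_mul, hsum, one_mul]

end Volume

open MeasureTheory in
/-- A compactly supported `C¹` perturbation of the identity is surjective. -/
theorem surjective_id_add {E : Type*} [NormedAddCommGroup E] [InnerProductSpace ℝ E]
    [FiniteDimensional ℝ E] {u : E → E} (hu : ContDiff ℝ 1 u) (hc : HasCompactSupport u) :
    Function.Surjective fun x => x + u x := by
  borelize E
  -- If `y` is missed, the image stays at distance at least `δ > 0` from `y`. The weight `(R² - ‖· -
  -- y‖²)^N` concentrates at `y` as `N` grows: its integral is at least `V b^N`, whereas by
  -- `setIntegral_det_mul_weight` it is at most `I a^N` with `a < b`.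
  by_contra hns
  simp only [Function.Surjective, not_forall, not_exists] at hns
  obtain ⟨y, hy⟩ := hns
  obtain ⟨C, hC⟩ := hc.exists_bound_of_continuous hu.continuous
  have hC0 : 0 ≤ C := (norm_nonneg _).trans (hC y)
  obtain ⟨r, hr⟩ := hc.isCompact.isBounded.subset_closedBall y
  -- The support of `u` lies in the ball of radius `r` and `‖u‖ ≤ C`, so the ball of radius `R` is
  -- mapped into itself and the weight is nonnegative on its image.
  set R := max r 0 + C + 1 with hRdef
  have hrR : r ≤ R := by linarith [le_max_left r 0]
  have hR0 : 0 < R := by linarith [le_max_right r 0]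
  have hzero : ∀ x ∉ Metric.closedBall y r, u x = 0 := fun x hx =>
    image_eq_zero_of_notMem_tsupport fun h => hx (hr h)
  have hzeroR : ∀ x ∉ Metric.closedBall y R, u x = 0 := fun x hx =>
    hzero x fun h => hx (Metric.closedBall_subset_closedBall hrR h)
  have hcpt := isCompact_closedBall y R
  have hcontφ : Continuous fun x => x + u x - y := by
    have := hu.continuous
    fun_prop
  have hle : ∀ x ∈ Metric.closedBall y R, ‖x + u x - y‖ ≤ R := by
    intro x hx
    by_cases h : x ∈ Metric.closedBall y r
    · rw [Metric.mem_closedBall, dist_eq_norm] at h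
      calc ‖x + u x - y‖ = ‖(x - y) + u x‖ := by congr 1; abel
        _ ≤ ‖x - y‖ + ‖u x‖ := norm_add_le _ _
        _ ≤ R := by linarith [hC x, le_max_left r 0]
    · rw [Metric.mem_closedBall, dist_eq_norm] at hx
      simpa [hzero x h] using hx
  obtain ⟨x₀, hx₀, hmin⟩ := hcpt.exists_isMinOn ⟨y, Metric.mem_closedBall_self hR0.le⟩
    hcontφ.norm.continuousOn
  set δ := ‖x₀ + u x₀ - y‖ with hδ
  have hδ0 : 0 < δ := norm_pos_iff.2 (sub_ne_zero.2 (hy x₀))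
  have hδR : δ ≤ R := hle x₀ hx₀
  set a := R ^ 2 - δ ^ 2 with ha
  set b := R ^ 2 - (δ / 2) ^ 2 with hb
  have ha0 : 0 ≤ a := by nlinarith
  have hab : a < b := by nlinarith
  set V := volume.real (Metric.closedBall y (δ / 2)) with hV
  have hV0 : 0 < V := ENNReal.toReal_pos
    (Metric.measure_closedBall_pos volume y (by positivity)).ne' measure_closedBall_lt_top.ne
  set I := ∫ x in Metric.closedBall y R,
    |(ContinuousLinearMap.id ℝ E + fderiv ℝ u x).det| with hI
  have hdet := continuous_det_id_add_fderiv hu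
  have hbound : ∀ N : ℕ, V * b ^ N ≤ I * a ^ N := by
    intro N
    have hlow : V * b ^ N ≤ ∫ x in Metric.closedBall y R, (R ^ 2 - ‖x - y‖ ^ 2) ^ N := by
      have hcw : Continuous fun x : E => (R ^ 2 - ‖x - y‖ ^ 2) ^ N := by fun_prop
      have hsub : Metric.closedBall y (δ / 2) ⊆ Metric.closedBall y R :=
        Metric.closedBall_subset_closedBall (by linarith)
      calc V * b ^ N = ∫ _ in Metric.closedBall y (δ / 2), b ^ N := by
            rw [setIntegral_const, smul_eq_mul]
        _ ≤ ∫ x in Metric.closedBall y (δ / 2), (R ^ 2 - ‖x - y‖ ^ 2) ^ N := by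
            refine setIntegral_mono_on (integrableOn_const measure_closedBall_lt_top.ne)
              (hcw.continuousOn.integrableOn_compact (isCompact_closedBall _ _))
              Metric.isClosed_closedBall.measurableSet fun x hx => ?_
            rw [Metric.mem_closedBall, dist_eq_norm] at hx
            have : ‖x - y‖ ^ 2 ≤ (δ / 2) ^ 2 := pow_le_pow_left₀ (norm_nonneg _) hx 2
            exact pow_le_pow_left₀ (ha0.trans hab.le) (by linarith) N
        _ ≤ _ := by
            refine setIntegral_mono_set (hcw.continuousOn.integrableOn_compact hcpt) ?_
              hsub.eventuallyLE
            refine (ae_restrict_iff' Metric.isClosed_closedBall.measurableSet).2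
              (Eventually.of_forall fun x hx => ?_)
            rw [Metric.mem_closedBall, dist_eq_norm] at hx
            have : ‖x - y‖ ^ 2 ≤ R ^ 2 := pow_le_pow_left₀ (norm_nonneg _) hx 2
            exact pow_nonneg (by linarith) N
    refine hlow.trans ?_
    rw [← setIntegral_det_mul_weight hu hc y hzeroR N, hI, ← integral_mul_const]
    refine setIntegral_mono_on ?_ ?_ Metric.isClosed_closedBall.measurableSet fun x hx => ?_
    · refine ContinuousOn.integrableOn_compact hcpt (Continuous.continuousOn ?_)
      exact hdet.mul ((continuous_const.sub (hcontφ.norm.pow 2)).pow N)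
    · refine ContinuousOn.integrableOn_compact hcpt (Continuous.continuousOn ?_)
      exact hdet.abs.mul continuous_const
    · have h1 : δ ^ 2 ≤ ‖x + u x - y‖ ^ 2 := pow_le_pow_left₀ hδ0.le (hmin hx) 2
      have h2 : ‖x + u x - y‖ ^ 2 ≤ R ^ 2 := pow_le_pow_left₀ (norm_nonneg _) (hle x hx) 2
      have h3 : (R ^ 2 - ‖x + u x - y‖ ^ 2) ^ N ≤ a ^ N :=
        pow_le_pow_left₀ (by linarith) (by linarith) N
      calc _ ≤ |(ContinuousLinearMap.id ℝ E + fderiv ℝ u x).det|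
              * (R ^ 2 - ‖x + u x - y‖ ^ 2) ^ N :=
            mul_le_mul_of_nonneg_right (le_abs_self _) (pow_nonneg (by linarith) N)
        _ ≤ _ := mul_le_mul_of_nonneg_left h3 (abs_nonneg _)
  have hb0 : 0 < b := ha0.trans_lt hab
  have hlim : Tendsto (fun N : ℕ => I * (a / b) ^ N) atTop (𝓝 (I * 0)) :=
    (tendsto_pow_atTop_nhds_zero_of_lt_one (by positivity) ((div_lt_one hb0).2 hab)).const_mul I
  have : V ≤ I * 0 := ge_of_tendsto' hlim fun N => by
    rw [div_pow, mul_div_assoc', le_div_iff₀ (pow_pos hb0 N)]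
    exact hbound N
  linarith

/-! ### Smooth approximation and the volume of continuous injective images -/

/-- A partition of unity glues local constants, the constraint being a convex ball over points of
`K` and empty elsewhere. -/
theorem exists_contDiff_approx_on_isClosed {E F : Type*} [NormedAddCommGroup E] [NormedSpace ℝ E]
    [FiniteDimensional ℝ E] [NormedAddCommGroup F] [NormedSpace ℝ F] {K : Set E}
    (hK : IsClosed K) {f : E → F} (hf : ContinuousOn f K) {ε : ℝ} (hε : 0 < ε) :
    ∃ g : E → F, ContDiff ℝ 1 g ∧ ∀ x ∈ K, ‖g x - f x‖ < ε := by
  classical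
  let t : E → Set F := fun x => if x ∈ K then Metric.ball (f x) ε else univ
  have ht : ∀ x, Convex ℝ (t x) := by
    intro x
    simp only [t]
    split_ifs
    exacts [convex_ball _ _, convex_univ]
  obtain ⟨g, hg⟩ := exists_contMDiffMap_forall_mem_convex_of_local_const (n := 1)
    (modelWithCornersSelf ℝ E) ht (by
      intro x
      refine ⟨f x, ?_⟩
      by_cases hx : x ∈ K
      · have h1 : ∀ᶠ y in 𝓝[K] x, f y ∈ Metric.ball (f x) ε :=
          hf x hx (Metric.ball_mem_nhds _ hε)
        filter_upwards [eventually_nhdsWithin_iff.1 h1] with y hy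
        simp only [t]
        split_ifs with h
        · rw [Metric.mem_ball_comm]
          exact hy h
        · trivial
      · filter_upwards [hK.isOpen_compl.mem_nhds hx] with y hy
        have : y ∉ K := hy
        simp [t, this])
  refine ⟨g, g.contMDiff.contDiff, fun x hx => ?_⟩
  have := hg x
  simp only [t, if_pos hx] at this
  rwa [Metric.mem_ball, dist_eq_norm] at this

/-- A continuous map of the closed unit ball that moves points by at most `1/4` has every point
of norm less than `1/4` in its image. -/
theorem mem_image_closedBall_of_near_id {E : Type*} [NormedAddCommGroup E]
    [InnerProductSpace ℝ E] [FiniteDimensional ℝ E] {f : E → E}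
    (hf : ContinuousOn f (Metric.closedBall 0 1))
    (hnear : ∀ x ∈ Metric.closedBall (0 : E) 1, ‖f x - x‖ ≤ 1 / 4) {y : E} (hy : ‖y‖ < 1 / 4) :
    y ∈ f '' Metric.closedBall 0 1 := by
  by_contra hcon
  have hcpt : IsCompact (f '' Metric.closedBall 0 1) :=
    (isCompact_closedBall 0 1).image_of_continuousOn hf
  obtain ⟨δ, hδ, hδ'⟩ := Metric.isOpen_iff.1 hcpt.isClosed.isOpen_compl y hcon
  obtain ⟨p, hp, hpf⟩ := exists_contDiff_approx_on_isClosed Metric.isClosed_closedBall hf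
    (lt_min hδ (show (0 : ℝ) < 1 / 4 by norm_num))
  have hpy : ∀ x ∈ Metric.closedBall (0 : E) 1, p x ≠ y := by
    intro x hx h
    apply hδ' (a := f x) _ ⟨x, hx, rfl⟩
    rw [Metric.mem_ball, dist_comm, dist_eq_norm, ← h]
    exact (hpf x hx).trans_le (min_le_left _ _)
  have hpx : ∀ x ∈ Metric.closedBall (0 : E) 1, ‖p x - x‖ < 1 / 2 := by
    intro x hx
    calc ‖p x - x‖ = ‖(p x - f x) + (f x - x)‖ := by congr 1; abel
      _ ≤ ‖p x - f x‖ + ‖f x - x‖ := norm_add_le _ _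
      _ < 1 / 2 := by
        have := (hpf x hx).trans_le (min_le_right _ _)
        linarith [hnear x hx]
  -- The displacement of `p` is below `1/2` and `‖y‖ < 1/4`, so a preimage of `y` under the cut-off
  -- map has norm below `3/4`, where the cutoff is `1` and the map is `p`.
  let χ : ContDiffBump (0 : E) := ⟨3 / 4, 1, by norm_num, by norm_num⟩
  have hu : ContDiff ℝ 1 fun x => χ x • (p x - x) :=
    χ.contDiff.smul (hp.sub contDiff_id)
  have hcs : HasCompactSupport fun x => χ x • (p x - x) := χ.hasCompactSupport.smul_right
  obtain ⟨x, hx⟩ := surjective_id_add hu hcs y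
  simp only at hx
  by_cases h1 : x ∈ Metric.closedBall (0 : E) 1
  · by_cases h2 : x ∈ Metric.closedBall (0 : E) (3 / 4)
    · rw [χ.one_of_mem_closedBall h2, one_smul, add_sub_cancel] at hx
      exact hpy x h1 hx
    · rw [mem_closedBall_zero_iff, not_le] at h2
      have h3 : ‖χ x • (p x - x)‖ ≤ ‖p x - x‖ := by
        rw [norm_smul, Real.norm_of_nonneg χ.nonneg]
        exact mul_le_of_le_one_left (norm_nonneg _) χ.le_one
      have h4 : ‖x‖ ≤ ‖y‖ + ‖χ x • (p x - x)‖ := by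
        have : x = y - χ x • (p x - x) := by rw [← hx]; abel
        conv_lhs => rw [this]
        exact norm_sub_le _ _
      linarith [hpx x h1]
  · rw [mem_closedBall_zero_iff, not_le] at h1
    rw [χ.zero_of_le_dist (by rw [dist_zero_right]; exact h1.le), zero_smul, add_zero] at hx
    rw [hx] at h1
    linarith

open MeasureTheory in
/-- The image of the closed unit ball under a continuous injection into a space of the same
dimension has positive volume. -/
theorem volume_image_closedBall_ne_zero {E : Type*} [NormedAddCommGroup E]
    [InnerProductSpace ℝ E] [FiniteDimensional ℝ E] [MeasurableSpace E] [BorelSpace E]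
    {f : E → E} (hf : ContinuousOn f (Metric.closedBall 0 1))
    (hinj : InjOn f (Metric.closedBall 0 1)) :
    volume (f '' Metric.closedBall 0 1) ≠ 0 := by
  intro hnull
  set B := Metric.closedBall (0 : E) 1
  have hBc : IsCompact B := isCompact_closedBall 0 1
  have hX : IsCompact (f '' B) := hBc.image_of_continuousOn hf
  -- A continuous injection of a compact set sends closed subsets to closed sets, so its inverse is
  -- continuous.
  have hinv : ContinuousOn (Function.invFunOn f B) (f '' B) := by
    rw [continuousOn_iff_isClosed]
    intro t ht
    refine ⟨f '' (B ∩ t), ((hBc.inter_right ht).image_of_continuousOn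
      (hf.mono inter_subset_left)).isClosed, ?_⟩
    ext z
    constructor
    · rintro ⟨hz, x, hx, rfl⟩
      refine ⟨⟨x, ⟨hx, ?_⟩, rfl⟩, ⟨x, hx, rfl⟩⟩
      rwa [mem_preimage, hinj.leftInvOn_invFunOn hx] at hz
    · rintro ⟨⟨x, ⟨hx, hxt⟩, rfl⟩, h⟩
      refine ⟨?_, h⟩
      rwa [mem_preimage, hinj.leftInvOn_invFunOn hx]
  obtain ⟨g, hg, hgf⟩ := exists_contDiff_approx_on_isClosed hX.isClosed hinv
    (show (0 : ℝ) < 1 / 4 by norm_num)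
  -- `g` is a `C¹` approximation of the inverse, so `g ∘ f` is close to the identity and covers a
  -- ball. But a differentiable map sends null sets to null sets.
  have hsub : Metric.ball (0 : E) (1 / 4) ⊆ g '' (f '' B) := by
    intro y hy
    rw [mem_ball_zero_iff] at hy
    rw [← image_comp]
    refine mem_image_closedBall_of_near_id (hg.continuous.comp_continuousOn hf) (fun x hx => ?_) hy
    have := hgf (f x) ⟨x, hx, rfl⟩
    rw [hinj.leftInvOn_invFunOn hx] at this
    exact this.le
  have h0 : volume (g '' (f '' B)) = 0 :=
    addHaar_image_eq_zero_of_differentiableOn_of_addHaar_eq_zero volume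
      (hg.differentiable one_ne_zero).differentiableOn hnull
  exact (Metric.measure_ball_pos volume (0 : E) (by norm_num : (0 : ℝ) < 1 / 4)).ne'
    (measure_mono_null hsub h0)

/-! ### Acausal sets and degenerate hyperplanes -/

theorem continuous_val {n : ℕ} : Continuous fun x : Ein n => x.1 := continuous_subtype_val

theorem ein_ext {n : ℕ} {x y : Ein n} (h : x.1 = y.1) : x = y := Subtype.ext h

theorem neg_val {n : ℕ} (x : Ein n) : (-x).1 = -x.1 := rfl

theorem exists_unit_orthogonal {n : ℕ} (hn : 2 ≤ n) (z : EuclideanSpace ℝ (Fin n)) :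
    ∃ e : EuclideanSpace ℝ (Fin n), ‖e‖ = 1 ∧ inner ℝ z e = 0 := by
  have h1 := Submodule.finrank_add_finrank_orthogonal (Submodule.span ℝ {z})
  have h2 : Module.finrank ℝ (Submodule.span ℝ {z}) ≤ 1 := by
    simpa using finrank_span_le_card (R := ℝ) ({z} : Set (EuclideanSpace ℝ (Fin n)))
  rw [finrank_euclideanSpace_fin] at h1
  have h3 : (Submodule.span ℝ {z})ᗮ ≠ ⊥ := by
    intro h
    rw [h, finrank_bot] at h1
    omega
  obtain ⟨v, hv, hv0⟩ := Submodule.exists_mem_ne_zero_of_ne_bot h3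
  refine ⟨‖v‖⁻¹ • v, ?_, ?_⟩
  · rw [norm_smul, norm_inv, norm_norm, inv_mul_cancel₀ (norm_ne_zero_iff.2 hv0)]
  · rw [inner_smul_right, Submodule.mem_orthogonal_singleton_iff_inner_right.1 hv, mul_zero]

theorem form_proj {n : ℕ} (p q : EinCover n) :
    form (proj p).1 (proj q).1 = -Real.cos (p.1 - q.1) + inner ℝ p.2.1 q.2.1 := by
  simp only [form, proj, Fin.sum_univ_two, Real.cos_sub, PiLp.inner_apply, Sum.elim_inl,
    Sum.elim_inr, Matrix.cons_val_zero, Matrix.cons_val_one]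
  simp [mul_comm]

theorem proj_surjective {n : ℕ} : Function.Surjective (proj (n := n)) := by
  intro x
  have h1 := x.2.1
  have h2 := x.2.2
  rw [Fin.sum_univ_two] at h1
  set c : ℂ := ⟨x.1 (Sum.inl 0), x.1 (Sum.inl 1)⟩ with hc
  have hnorm : ‖c‖ = 1 := by
    rw [← sq_eq_sq₀ (norm_nonneg _) zero_le_one, Complex.sq_norm, Complex.normSq_apply, hc]
    simp only
    linarith
  have hc0 : c ≠ 0 := norm_ne_zero_iff.1 (by rw [hnorm]; exact one_ne_zero)
  have hcos : Real.cos (Complex.arg c) = x.1 (Sum.inl 0) := by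
    rw [Complex.cos_arg hc0, hnorm, div_one]
  have hsin : Real.sin (Complex.arg c) = x.1 (Sum.inl 1) := by
    rw [Complex.sin_arg, hnorm, div_one]
  refine ⟨(Complex.arg c, ⟨WithLp.toLp 2 fun j => x.1 (Sum.inr j), ?_⟩), ein_ext ?_⟩
  · rw [mem_sphere_zero_iff_norm, EuclideanSpace.norm_eq, Real.sqrt_eq_one]
    simpa using h2
  · funext k
    rcases k with i | j
    · fin_cases i
      · simpa [proj] using hcos
      · simpa [proj] using hsin
    · simp [proj]

/-- Follow a minimizing great circle arc from `p.2` to `q.2` at constant speed `d`, the angle, while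
`θ` grows at constant speed `b - a ≥ d`. -/
theorem exists_causal_curve {n : ℕ} (hn : 2 ≤ n) {p q : EinCover n} (hpq : p ≠ q)
    (h : InnerProductGeometry.angle p.2.1 q.2.1 ≤ q.1 - p.1) :
    ∃ θ z, IsCausalCurve θ z p q := by
  obtain ⟨a, z, hz⟩ := p
  obtain ⟨b, w, hw⟩ := q
  simp only at h
  rw [mem_sphere_zero_iff_norm] at hz hw
  set d := InnerProductGeometry.angle z w with hd
  have hd0 : 0 ≤ d := InnerProductGeometry.angle_nonneg _ _
  have hcos : Real.cos d = inner ℝ z w := by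
    rw [hd, InnerProductGeometry.cos_angle, hz, hw]; simp
  obtain ⟨e, he, hze, hwe⟩ : ∃ e : EuclideanSpace ℝ (Fin n), ‖e‖ = 1 ∧ inner ℝ z e = 0 ∧
      w = Real.cos d • z + Real.sin d • e := by
    have hnorm : ‖w - Real.cos d • z‖ ^ 2 = Real.sin d ^ 2 := by
      rw [norm_sub_sq_real, hw, norm_smul, hz, inner_smul_right, real_inner_comm, ← hcos,
        Real.norm_eq_abs, mul_one, sq_abs, Real.sin_sq]
      ring
    -- Equal or antipodal endpoints do not determine the direction `e`; any unit vector orthogonal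
    -- to `z` serves, and one exists since `n ≥ 2`.
    by_cases hs : Real.sin d = 0
    · obtain ⟨e, he, hze⟩ := exists_unit_orthogonal hn z
      refine ⟨e, he, hze, ?_⟩
      rw [hs, zero_pow two_ne_zero, sq_eq_zero_iff, norm_eq_zero, sub_eq_zero] at hnorm
      rw [hs, zero_smul, add_zero, ← hnorm]
    · refine ⟨(Real.sin d)⁻¹ • (w - Real.cos d • z), ?_, ?_, ?_⟩
      · rw [← sq_eq_sq₀ (norm_nonneg _) zero_le_one, norm_smul, mul_pow, hnorm, Real.norm_eq_abs,
          sq_abs, ← mul_pow, inv_mul_cancel₀ hs]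
      · rw [inner_smul_right, inner_sub_right, inner_smul_right, real_inner_self_eq_norm_sq, hz,
          hcos]
        ring
      · rw [smul_smul, mul_inv_cancel₀ hs, one_smul, add_sub_cancel]
  have hlt : 0 < b - a := by
    rcases (hd0.trans h).lt_or_eq with h' | h'
    · exact h'
    · exfalso
      have hd1 : d = 0 := le_antisymm (by rw [h']; exact h) hd0
      apply hpq
      have hzw : w = z := by simpa [hd1] using hwe
      have hab : a = b := by linarith
      subst hab
      simp [hzw]
  have hder : ∀ t : ℝ, HasDerivAt (fun t : ℝ => Real.cos (t * d) • z + Real.sin (t * d) • e)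
      ((-Real.sin (t * d) * d) • z + (Real.cos (t * d) * d) • e) t := by
    intro t
    have h1 : HasDerivAt (fun t : ℝ => t * d) d t := by
      simpa using (hasDerivAt_id t).mul_const d
    exact (h1.cos.smul_const z).add (h1.sin.smul_const e)
  have hderθ : ∀ t : ℝ, HasDerivAt (fun t : ℝ => a + t * (b - a)) (b - a) t := by
    intro t
    simpa using ((hasDerivAt_id t).mul_const (b - a)).const_add a
  have hcomb : ∀ r s : ℝ, ‖r • z + s • e‖ ^ 2 = r ^ 2 + s ^ 2 := by
    intro r s
    rw [norm_add_sq_real, norm_smul, norm_smul, hz, he, inner_smul_left, inner_smul_right, hze]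
    simp
  have huniq : ∀ t ∈ Icc (0 : ℝ) 1, UniqueDiffWithinAt ℝ (Icc (0 : ℝ) 1) t :=
    uniqueDiffOn_Icc zero_lt_one
  refine ⟨fun t => a + t * (b - a), fun t => Real.cos (t * d) • z + Real.sin (t * d) • e,
    ?_, ?_, ?_, ?_, ?_, ?_⟩
  · exact ContDiff.contDiffOn (by fun_prop)
  · refine ContDiff.contDiffOn ?_
    have h1 : ContDiff ℝ 1 fun t : ℝ => t * d := by fun_prop
    exact (h1.cos.smul contDiff_const).add (h1.sin.smul contDiff_const)
  · intro t _
    rw [← sq_eq_sq₀ (norm_nonneg _) zero_le_one, hcomb, Real.cos_sq_add_sin_sq, one_pow]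
  · intro t ht
    rw [(hderθ t).hasDerivWithinAt.derivWithin (huniq t ht),
      (hder t).hasDerivWithinAt.derivWithin (huniq t ht)]
    refine ⟨hlt, ?_⟩
    have : ‖(-Real.sin (t * d) * d) • z + (Real.cos (t * d) * d) • e‖ = d := by
      rw [← sq_eq_sq₀ (norm_nonneg _) hd0, hcomb, mul_pow, mul_pow, neg_sq, ← add_mul,
        Real.sin_sq_add_cos_sq, one_mul]
    rw [this]
    exact h
  · simp
  · simp [← hwe]

/-- With no causal curve in either direction, the time difference is strictly less than the
spherical angle. As cosine decreases on `[0, π]`, the difference of the two cosines has a sign. -/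
theorem form_neg_of_isAcausal {n : ℕ} (hn : 2 ≤ n) {Λ : Set (Ein n)} (hΛ : IsAcausal Λ)
    {x y : Ein n} (hx : x ∈ Λ) (hy : y ∈ Λ) (hxy : x ≠ y) : form x.1 y.1 < 0 := by
  obtain ⟨S, hS, hac⟩ := hΛ
  rw [← hS] at hx hy
  obtain ⟨p, hp, rfl⟩ := hx
  obtain ⟨q, hq, rfl⟩ := hy
  have hpq : p ≠ q := fun h => hxy (by rw [h])
  have h1 : q.1 - p.1 < InnerProductGeometry.angle p.2.1 q.2.1 := by
    by_contra h
    exact hac p hp q hq hpq (exists_causal_curve hn hpq (not_lt.1 h))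
  have h2 : p.1 - q.1 < InnerProductGeometry.angle p.2.1 q.2.1 := by
    by_contra h
    rw [InnerProductGeometry.angle_comm] at h
    exact hac q hq p hp hpq.symm (exists_causal_curve hn hpq.symm (not_lt.1 h))
  have h3 : |p.1 - q.1| < InnerProductGeometry.angle p.2.1 q.2.1 :=
    abs_lt.2 ⟨by linarith, h2⟩
  have h4 := Real.cos_lt_cos_of_nonneg_of_le_pi (abs_nonneg _)
    (InnerProductGeometry.angle_le_pi _ _) h3
  rw [Real.cos_abs, InnerProductGeometry.cos_angle, mem_sphere_zero_iff_norm.1 p.2.2,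
    mem_sphere_zero_iff_norm.1 q.2.2] at h4
  rw [form_proj]
  simp only [mul_one, div_one] at h4
  linarith

/-! ### The limit set lies in no degenerate hyperplane -/

open MeasureTheory in
/-- A sphere of dimension `n - 1` does not inject continuously into the unit sphere of a hyperplane
of `ℝⁿ`. -/
theorem not_injective_sphere_to_hyperplane {n : ℕ} {z₀ : EuclideanSpace ℝ (Fin n)}
    (hz₀ : ‖z₀‖ = 1) {E : Submodule ℝ (EuclideanSpace ℝ (Fin n))}
    (hE : ∀ x ∈ E, inner ℝ x z₀ = 0)
    {f : Metric.sphere (0 : EuclideanSpace ℝ (Fin n)) 1 → E}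
    (hf : Continuous f) (hnorm : ∀ x, ‖f x‖ = 1) : ¬ Function.Injective f := by
  intro hinj
  have hsq : ∀ x : E, ‖(x : EuclideanSpace ℝ (Fin n)) + Real.sqrt (1 - ‖x‖ ^ 2) • z₀‖ ^ 2
      = ‖x‖ ^ 2 + Real.sqrt (1 - ‖x‖ ^ 2) ^ 2 := by
    intro x
    rw [norm_add_sq_real, inner_smul_right, hE x x.2, norm_smul, hz₀]
    simp
  have hle : ∀ x ∈ Metric.closedBall (0 : E) 1, 0 ≤ 1 - ‖x‖ ^ 2 := by
    intro x hx
    rw [mem_closedBall_zero_iff] at hx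
    nlinarith [norm_nonneg x]
  -- Parametrizes part of the sphere, over the unit ball of `E`, by a graph in the direction `z₀`.
  -- Composed with `f`, it injects that ball into the unit sphere of `E`, which is null.
  let s : Metric.closedBall (0 : E) 1 → Metric.sphere (0 : EuclideanSpace ℝ (Fin n)) 1 := fun x =>
    ⟨(x.1 : EuclideanSpace ℝ (Fin n)) + Real.sqrt (1 - ‖x.1‖ ^ 2) • z₀, by
      rw [mem_sphere_zero_iff_norm, ← sq_eq_sq₀ (norm_nonneg _) zero_le_one, hsq,
        Real.sq_sqrt (hle x.1 x.2)]
      ring⟩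
  have hs : Continuous s := by
    refine Continuous.subtype_mk ?_ _
    fun_prop
  have hsinj : Function.Injective s := by
    intro x y hxy
    have h1 : (x.1 : EuclideanSpace ℝ (Fin n)) + Real.sqrt (1 - ‖x.1‖ ^ 2) • z₀
        = y.1 + Real.sqrt (1 - ‖y.1‖ ^ 2) • z₀ := congrArg Subtype.val hxy
    have h2 := congrArg (fun v => inner ℝ v z₀) h1
    have h4 : inner ℝ z₀ z₀ = (1 : ℝ) := by rw [real_inner_self_eq_norm_sq, hz₀, one_pow]
    simp only [inner_add_left, inner_smul_left, hE _ x.1.2, hE _ y.1.2, h4] at h2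
    have h5 : Real.sqrt (1 - ‖x.1‖ ^ 2) = Real.sqrt (1 - ‖y.1‖ ^ 2) := by simpa using h2
    rw [h5, add_left_inj] at h1
    exact Subtype.ext (Subtype.ext h1)
  classical
  let g : E → E := fun x => if hx : x ∈ Metric.closedBall (0 : E) 1 then f (s ⟨x, hx⟩) else 0
  have hg : ∀ x : Metric.closedBall (0 : E) 1, g x = f (s x) := fun x => dif_pos x.2
  have hgc : ContinuousOn g (Metric.closedBall 0 1) := by
    rw [continuousOn_iff_continuous_domRestrict]
    exact (hf.comp hs).congr fun x => (hg x).symm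
  have hgi : InjOn g (Metric.closedBall 0 1) := by
    intro x hx y hy hxy
    rw [hg ⟨x, hx⟩, hg ⟨y, hy⟩] at hxy
    exact congrArg Subtype.val (hsinj (hinj hxy))
  refine volume_image_closedBall_ne_zero hgc hgi (measure_mono_null ?_
    (Measure.addHaar_sphere_of_ne_zero volume (0 : E) one_ne_zero))
  rintro _ ⟨x, hx, rfl⟩
  rw [hg ⟨x, hx⟩, mem_sphere_zero_iff_norm]
  exact hnorm _

/-- If `Λ ⊂ q^⊥`, the form on `Λ` descends to the Lorentzian quotient `q^⊥ / ℝ q`, with time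
coordinate `b` and space coordinate `w ∈ z₀^⊥`. There every point is isotropic, `‖w‖² = b²`, so `w /
b` maps `Λ` to the unit sphere of `z₀^⊥`. Two points with the same image are orthogonal, which
negativity forbids when they are distinct. -/
theorem exists_form_ne_zero {n : ℕ} {Λ : Set (Ein n)}
    (hneg : ∀ x ∈ Λ, ∀ y ∈ Λ, x ≠ y → form x.1 y.1 < 0)
    (hsph : Nonempty (Λ ≃ₜ Metric.sphere (0 : EuclideanSpace ℝ (Fin n)) 1)) (q : Ein n) :
    ∃ y ∈ Λ, form y.1 q.1 ≠ 0 := by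
  by_contra! hcon
  obtain ⟨h⟩ := hsph
  obtain ⟨⟨θ, z₀, hz₀⟩, rfl⟩ := proj_surjective q
  rw [mem_sphere_zero_iff_norm] at hz₀
  let a : Ein n → ℝ := fun y => Real.cos θ * y.1 (Sum.inl 0) + Real.sin θ * y.1 (Sum.inl 1)
  let b : Ein n → ℝ := fun y => -Real.sin θ * y.1 (Sum.inl 0) + Real.cos θ * y.1 (Sum.inl 1)
  let z : Ein n → EuclideanSpace ℝ (Fin n) := fun y => WithLp.toLp 2 fun j => y.1 (Sum.inr j)
  have hval : ∀ k, Continuous fun y : Ein n => y.1 k := fun k =>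
    (continuous_apply k).comp continuous_val
  have ha : Continuous a :=
    (continuous_const.mul (hval _)).add (continuous_const.mul (hval _))
  have hb : Continuous b :=
    (continuous_const.mul (hval _)).add (continuous_const.mul (hval _))
  have hz : Continuous z :=
    (PiLp.continuous_toLp 2 _).comp (continuous_pi fun j => hval (Sum.inr j))
  have hform : ∀ x y, form x.1 y.1 = -(a x * a y + b x * b y) + inner ℝ (z x) (z y) := by
    intro x y
    simp only [form, a, b, z, Fin.sum_univ_two, PiLp.inner_apply]
    simp only [RCLike.inner_apply, conj_trivial, mul_comm (y.1 (Sum.inr _))]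
    linear_combination (x.1 (Sum.inl 0) * y.1 (Sum.inl 0) + x.1 (Sum.inl 1) * y.1 (Sum.inl 1))
      * Real.sin_sq_add_cos_sq θ
  have hab : ∀ y, a y ^ 2 + b y ^ 2 = 1 := by
    intro y
    have := y.2.1
    rw [Fin.sum_univ_two] at this
    simp only [a, b]
    linear_combination this + (y.1 (Sum.inl 0) ^ 2 + y.1 (Sum.inl 1) ^ 2)
      * (Real.sin_sq_add_cos_sq θ)
  have hzn : ∀ y, ‖z y‖ = 1 := by
    intro y
    rw [EuclideanSpace.norm_eq, Real.sqrt_eq_one]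
    simpa [z] using y.2.2
  have hzz₀ : ∀ y ∈ Λ, inner ℝ (z y) z₀ = a y := by
    intro y hy
    have := hcon y hy
    simp only [form, proj, Fin.sum_univ_two, Sum.elim_inl, Sum.elim_inr,
      Matrix.cons_val_zero, Matrix.cons_val_one] at this
    simp only [a, z, PiLp.inner_apply, RCLike.inner_apply, conj_trivial]
    simp only [mul_comm (z₀ _)]
    linarith
  let w : Ein n → EuclideanSpace ℝ (Fin n) := fun y => z y - a y • z₀
  have hz₀z₀ : inner ℝ z₀ z₀ = (1 : ℝ) := by rw [real_inner_self_eq_norm_sq, hz₀, one_pow]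
  have hww : ∀ x ∈ Λ, ∀ y ∈ Λ, inner ℝ (w x) (w y) = inner ℝ (z x) (z y) - a x * a y := by
    intro x hx y hy
    have : inner ℝ z₀ (z y) = a y := by rw [real_inner_comm, hzz₀ y hy]
    simp only [w, inner_sub_left, inner_sub_right, inner_smul_left, inner_smul_right, hz₀z₀,
      hzz₀ x hx, this, conj_trivial]
    ring
  have hform' : ∀ x ∈ Λ, ∀ y ∈ Λ, form x.1 y.1 = -(b x * b y) + inner ℝ (w x) (w y) := by
    intro x hx y hy
    rw [hform, hww x hx y hy]
    ring
  have hwn : ∀ x ∈ Λ, ‖w x‖ ^ 2 = b x ^ 2 := by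
    intro x hx
    rw [← real_inner_self_eq_norm_sq, hww x hx x hx, real_inner_self_eq_norm_sq, hzn]
    linarith [hab x]
  have hb0 : ∀ x ∈ Λ, b x ≠ 0 := by
    intro x hx h0
    have hw0 : w x = 0 := by
      have := hwn x hx
      rwa [h0, zero_pow two_ne_zero, sq_eq_zero_iff, norm_eq_zero] at this
    -- If `b x = 0` then `w x = 0` and `x` is orthogonal to all of `Λ`; a second point of `Λ`,
    -- coming from a pair of antipodes of the sphere, contradicts this.
    obtain ⟨y, hyΛ, hyx⟩ : ∃ y ∈ Λ, y ≠ x := by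
      by_contra! hall
      let v : Metric.sphere (0 : EuclideanSpace ℝ (Fin n)) 1 := ⟨z₀, by simpa using hz₀⟩
      have h1 : h.symm v = h.symm (-v) := Subtype.ext
        ((hall _ (h.symm v).2).trans (hall _ (h.symm (-v)).2).symm)
      have h2 : z₀ = -z₀ := congrArg Subtype.val (h.symm.injective h1)
      have h3 : z₀ = 0 := by
        rw [eq_neg_iff_add_eq_zero, ← two_smul ℝ, smul_eq_zero] at h2
        exact h2.resolve_left two_ne_zero
      rw [h3, norm_zero] at hz₀
      exact zero_ne_one hz₀
    have := hneg x hx y hyΛ hyx.symm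
    rw [hform' x hx y hyΛ, h0, hw0] at this
    simp at this
  let f : Metric.sphere (0 : EuclideanSpace ℝ (Fin n)) 1 → (Submodule.span ℝ {z₀})ᗮ := fun s =>
    ⟨(b (h.symm s).1)⁻¹ • w (h.symm s).1, by
      refine Submodule.smul_mem _ _ ?_
      rw [Submodule.mem_orthogonal_singleton_iff_inner_left]
      simp only [w, inner_sub_left, inner_smul_left, hz₀z₀, hzz₀ _ (h.symm s).2, conj_trivial]
      ring⟩
  have hfc : Continuous f := by
    have hs : Continuous fun s => (h.symm s).1 := continuous_subtype_val.comp h.symm.continuous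
    refine Continuous.subtype_mk ?_ _
    exact ((hb.comp hs).inv₀ fun s => hb0 _ (h.symm s).2).smul
      ((hz.comp hs).sub ((ha.comp hs).smul continuous_const))
  have hfn : ∀ s, ‖f s‖ = 1 := by
    intro s
    have h1 := hwn _ (h.symm s).2
    have h2 := hb0 _ (h.symm s).2
    rw [← sq_eq_sq₀ (norm_nonneg _) zero_le_one]
    simp only [f, Submodule.coe_norm, norm_smul, mul_pow, h1, norm_inv, inv_pow,
      Real.norm_eq_abs, sq_abs]
    rw [one_pow, inv_mul_cancel₀ (pow_ne_zero 2 h2)]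
  refine not_injective_sphere_to_hyperplane hz₀
    (fun _ => Submodule.mem_orthogonal_singleton_iff_inner_left.1) hfc hfn fun s t hst => ?_
  by_contra hne
  set x := h.symm s
  set y := h.symm t
  have hxy : x.1 ≠ y.1 := fun h' => hne (h.symm.injective (Subtype.ext h'))
  have h1 : (b x.1)⁻¹ • w x.1 = (b y.1)⁻¹ • w y.1 := congrArg Subtype.val hst
  have h2 : w x.1 = (b x.1 / b y.1) • w y.1 := by
    rw [div_eq_mul_inv, mul_smul, ← h1, smul_smul, mul_inv_cancel₀ (hb0 _ x.2), one_smul]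
  have h3 := hneg x.1 x.2 y.1 y.2 hxy
  rw [hform' _ x.2 _ y.2, h2, inner_smul_left, real_inner_self_eq_norm_sq, hwn _ y.2] at h3
  have h4 : b x.1 / b y.1 * b y.1 ^ 2 = b x.1 * b y.1 := by
    have := hb0 _ y.2
    field_simp
  simp only [conj_trivial, h4] at h3
  linarith

/-! ### Adjoints, and compactness in the orthogonal group -/

/-- The diagonal entries of the form. -/
def signature (n : ℕ) : Fin 2 ⊕ Fin n → ℝ := Sum.elim (fun _ => -1) (fun _ => 1)

theorem signature_mul_self {n : ℕ} (k : Fin 2 ⊕ Fin n) : signature n k * signature n k = 1 := by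
  rcases k with i | j <;> simp [signature]

theorem abs_signature {n : ℕ} (k : Fin 2 ⊕ Fin n) : |signature n k| = 1 := by
  rcases k with i | j <;> simp [signature]

theorem form_eq_sum {n : ℕ} (v w : V n) : form v w = ∑ k, signature n k * (v k * w k) := by
  simp [form, signature, Fintype.sum_sum_type]

theorem form_comm {n : ℕ} (v w : V n) : form v w = form w v := by
  simp only [form_eq_sum, mul_comm (v _)]

theorem form_add_left {n : ℕ} (u v w : V n) : form (u + v) w = form u w + form v w := by
  simp only [form_eq_sum, ← Finset.sum_add_distrib, Pi.add_apply]
  exact Finset.sum_congr rfl fun k _ => by ring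

theorem form_smul_left {n : ℕ} (c : ℝ) (v w : V n) : form (c • v) w = c * form v w := by
  simp only [form_eq_sum, Finset.mul_sum, Pi.smul_apply, smul_eq_mul]
  exact Finset.sum_congr rfl fun k _ => by ring

theorem form_add_right {n : ℕ} (u v w : V n) : form u (v + w) = form u v + form u w := by
  rw [form_comm, form_add_left, form_comm v, form_comm w]

theorem form_smul_right {n : ℕ} (c : ℝ) (v w : V n) : form v (c • w) = c * form v w := by
  rw [form_comm, form_smul_left, form_comm]

theorem form_single {n : ℕ} (k : Fin 2 ⊕ Fin n) (w : V n) :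
    form (Pi.single k 1) w = signature n k * w k := by
  rw [form_eq_sum, Finset.sum_eq_single k]
  · simp
  · intro j _ hj
    simp [Pi.single_eq_of_ne hj]
  · simp

theorem ext_form_right {n : ℕ} {w w' : V n} (h : ∀ v, form v w = form v w') : w = w' := by
  funext k
  have := h (Pi.single k 1)
  rw [form_single, form_single] at this
  have h2 := congrArg (signature n k * ·) this
  simpa only [← mul_assoc, signature_mul_self, one_mul] using h2

theorem continuous_form {n : ℕ} : Continuous fun p : V n × V n => form p.1 p.2 := by
  simp only [form]
  fun_prop

theorem Ein.form_self_eq_zero {n : ℕ} (x : Ein n) : form x.1 x.1 = 0 := by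
  rw [form_self, x.2.1, x.2.2]
  norm_num

/-- The adjoint of a matrix with respect to the form. -/
def adj {n : ℕ} (A : Matrix (Fin 2 ⊕ Fin n) (Fin 2 ⊕ Fin n) ℝ) :
    Matrix (Fin 2 ⊕ Fin n) (Fin 2 ⊕ Fin n) ℝ :=
  Matrix.of fun i j => signature n i * A j i * signature n j

theorem adj_smul {n : ℕ} (c : ℝ) (A : Matrix (Fin 2 ⊕ Fin n) (Fin 2 ⊕ Fin n) ℝ) :
    adj (c • A) = c • adj A := by
  ext i j
  simp only [adj, Matrix.of_apply, Matrix.smul_apply, smul_eq_mul]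
  ring

theorem continuous_adj {n : ℕ} : Continuous (adj (n := n)) := by
  refine continuous_matrix fun i j => ?_
  simp only [adj, Matrix.of_apply]
  fun_prop

theorem form_mulVec_left {n : ℕ} (A : Matrix (Fin 2 ⊕ Fin n) (Fin 2 ⊕ Fin n) ℝ) (v w : V n) :
    form (A.mulVec v) w = form v ((adj A).mulVec w) := by
  simp only [form_eq_sum, Matrix.mulVec, dotProduct, adj, Matrix.of_apply, Finset.mul_sum,
    Finset.sum_mul]
  rw [Finset.sum_comm]
  refine Finset.sum_congr rfl fun i _ => Finset.sum_congr rfl fun j _ => ?_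
  linear_combination (- A j i * v i * signature n j * w j) * signature_mul_self i

theorem adj_mul_self {n : ℕ} (g : SO n) : adj g.1.1 * g.1.1 = 1 := by
  refine Matrix.mulVec_injective (funext fun w => ext_form_right fun v => ?_)
  rw [← Matrix.mulVec_mulVec, ← form_mulVec_left, g.2.1, Matrix.one_mulVec]

theorem val_inv {n : ℕ} (g : SO n) : (g⁻¹).1.1 = adj g.1.1 := by
  have h : g.1.1 * (g⁻¹).1.1 = 1 := by
    change g.1.1 * (g.1⁻¹).1 = 1
    rw [← Units.val_mul, mul_inv_cancel, Units.val_one]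
  calc (g⁻¹).1.1 = adj g.1.1 * g.1.1 * (g⁻¹).1.1 := by rw [adj_mul_self, one_mul]
    _ = adj g.1.1 := by rw [mul_assoc, h, mul_one]

open scoped Matrix.Norms.Elementwise

theorem norm_adj_le {n : ℕ} (A : Matrix (Fin 2 ⊕ Fin n) (Fin 2 ⊕ Fin n) ℝ) : ‖adj A‖ ≤ ‖A‖ := by
  rw [Matrix.norm_le_iff (norm_nonneg _)]
  intro i j
  rw [adj, Matrix.of_apply, norm_mul, norm_mul, Real.norm_eq_abs, Real.norm_eq_abs (signature n j),
    abs_signature, abs_signature, one_mul, mul_one]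
  exact Matrix.norm_entry_le_entrywise_sup_norm A

theorem isClosed_SO (n : ℕ) : IsClosed (SO n : Set (GL (Fin 2 ⊕ Fin n) ℝ)) := by
  have h : (SO n : Set (GL (Fin 2 ⊕ Fin n) ℝ)) =
      (⋂ v : V n, ⋂ w : V n, {g | form (g.1.mulVec v) (g.1.mulVec w) = form v w})
        ∩ {g | g.1.det = 1} := by
    ext g
    simp [SO]
  have hc : ∀ v : V n, Continuous fun g : GL (Fin 2 ⊕ Fin n) ℝ => g.1.mulVec v := fun v =>
    Units.continuous_val.matrix_mulVec continuous_const
  rw [h]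
  refine IsClosed.inter (isClosed_iInter fun v => isClosed_iInter fun w => ?_) ?_
  · exact isClosed_eq (continuous_form.comp ((hc v).prodMk (hc w))) continuous_const
  · exact isClosed_eq Units.continuous_val.matrix_det continuous_const

/-- `GL` embeds as a closed subset through the pair of a matrix and its inverse. In the orthogonal
group the inverse is the adjoint, whose norm is controlled by that of the matrix, so bounding one
factor bounds both. -/
theorem isCompact_norm_le (n : ℕ) (C : ℝ) : IsCompact {g : SO₀ n | ‖g.1.1.1‖ ≤ C} := by
  have h0 : IsClosed (SO₀ n : Set (SO n)) := isClosed_connectedComponent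
  have hemb := (Units.isClosedEmbedding_embedProduct
    (α := Matrix (Fin 2 ⊕ Fin n) (Fin 2 ⊕ Fin n) ℝ)).comp
      ((isClosed_SO n).isClosedEmbedding_subtypeVal.comp h0.isClosedEmbedding_subtypeVal)
  have hK : IsCompact ((Metric.closedBall (0 : Matrix (Fin 2 ⊕ Fin n) (Fin 2 ⊕ Fin n) ℝ) C) ×ˢ
      (MulOpposite.opHomeomorph '' Metric.closedBall
        (0 : Matrix (Fin 2 ⊕ Fin n) (Fin 2 ⊕ Fin n) ℝ) C)) :=
    (isCompact_closedBall _ _).prod ((isCompact_closedBall _ _).image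
      MulOpposite.opHomeomorph.continuous)
  refine (hemb.isCompact_preimage hK).of_isClosed_subset ?_ ?_
  · exact isClosed_le (Units.continuous_val.comp
      (continuous_subtype_val.comp continuous_subtype_val)).norm continuous_const
  · intro g hg
    refine ⟨?_, (g.1⁻¹).1.1, ?_, rfl⟩
    · rw [mem_closedBall_zero_iff]
      exact hg
    · rw [mem_closedBall_zero_iff, val_inv]
      exact (norm_adj_le _).trans hg

theorem norm_val_pos {n : ℕ} (g : SO n) : 0 < ‖g.1.1‖ := by
  rw [norm_pos_iff]
  intro h
  have := g.2.2
  rw [h, Matrix.det_zero] at this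
  exact zero_ne_one this

/-- A discrete subgroup meets each compact set in finitely many elements, in particular the sets of
bounded norm. -/
theorem tendsto_norm_atTop {n : ℕ} {Γ : Type*} [Group Γ] {ρ : Γ →* SO₀ n}
    (hρ : Function.Injective ρ) (hd : DiscreteTopology ρ.range) :
    Tendsto (fun γ => ‖(ρ γ).1.1.1‖) cofinite atTop := by
  have h := MonoidHom.tendsto_coe_cofinite_of_discrete hρ (isDiscrete_iff_discreteTopology.2 hd)
  refine tendsto_atTop.2 fun C => ?_
  filter_upwards [h (isCompact_norm_le n C).compl_mem_cocompact] with γ hγ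
  exact le_of_not_ge hγ

/-! ### Limits of rescaled sequences -/

theorem negNorm_smul {n : ℕ} {c : ℝ} (hc : 0 ≤ c) (v : V n) : negNorm (c • v) = c * negNorm v := by
  simp only [negNorm, Pi.smul_apply, smul_eq_mul, mul_pow, ← Finset.mul_sum]
  rw [Real.sqrt_mul (sq_nonneg c), Real.sqrt_sq hc]

theorem Ein.negNorm_val {n : ℕ} (x : Ein n) : negNorm x.1 = 1 := by
  rw [negNorm, x.2.1, Real.sqrt_one]

theorem continuous_negNorm {n : ℕ} : Continuous (negNorm (n := n)) := by
  unfold negNorm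
  fun_prop

theorem exists_ein_of_isotropic {n : ℕ} {v : V n} (h0 : v ≠ 0) (h : form v v = 0) :
    ∃ (x : Ein n) (c : ℝ), 0 < c ∧ v = c • x.1 := by
  have hp := sum_sq_pos_of_isotropic v h0 h
  have hN : 0 < negNorm v := Real.sqrt_pos.2 hp
  have hs : (negNorm v)⁻¹ ^ 2 = (∑ i : Fin 2, v (Sum.inl i) ^ 2)⁻¹ := by
    rw [inv_pow, negNorm, Real.sq_sqrt hp.le]
  rw [form_self] at h
  refine ⟨⟨(negNorm v)⁻¹ • v, ?_, ?_⟩, negNorm v, hN, ?_⟩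
  · simp only [Pi.smul_apply, smul_eq_mul, mul_pow, hs, ← Finset.mul_sum]
    exact inv_mul_cancel₀ hp.ne'
  · simp only [Pi.smul_apply, smul_eq_mul, mul_pow, hs, ← Finset.mul_sum]
    rw [inv_mul_eq_one₀ hp.ne']
    linarith
  · rw [smul_smul, mul_inv_cancel₀ hN.ne', one_smul]

theorem act_val {n : ℕ} (g : SO n) (x : Ein n) {c : ℝ} (hc : 0 < c) :
    (act g x).1 = (negNorm ((c • g.1.1).mulVec x.1))⁻¹ • (c • g.1.1).mulVec x.1 := by
  rw [Matrix.smul_mulVec, negNorm_smul hc.le, smul_smul, mul_inv, mul_comm c⁻¹, mul_assoc,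
    inv_mul_cancel₀ hc.ne', mul_one]
  rfl

theorem isInducing_val {n : ℕ} : IsInducing fun x : Ein n => x.1 := ⟨rfl⟩

/-- Normalization is continuous away from zero, and the action ignores the positive factor `s k`.
Convergence is joint in the index and the point, which yields uniformity on compact sets. -/
theorem tendsto_act {n : ℕ} {g : ℕ → SO n} {s : ℕ → ℝ} (hs : ∀ k, 0 < s k)
    {M : Matrix (Fin 2 ⊕ Fin n) (Fin 2 ⊕ Fin n) ℝ}
    (hM : Tendsto (fun k => s k • (g k).1.1) atTop (𝓝 M)) {x p : Ein n} {μ : ℝ} (hμ : 0 < μ)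
    (hx : M.mulVec x.1 = μ • p.1) :
    Tendsto (fun q : ℕ × Ein n => act (g q.1) q.2) (atTop ×ˢ 𝓝 x) (𝓝 p) := by
  refine (isInducing_val.tendsto_nhds_iff).2 ?_
  have h1 : Tendsto (fun q : ℕ × Ein n => (s q.1 • (g q.1).1.1).mulVec q.2.1)
      (atTop ×ˢ 𝓝 x) (𝓝 (M.mulVec x.1)) := by
    have hc : Continuous fun q : Matrix (Fin 2 ⊕ Fin n) (Fin 2 ⊕ Fin n) ℝ × V n =>
        q.1.mulVec q.2 := continuous_fst.matrix_mulVec continuous_snd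
    exact (hc.tendsto (M, x.1)).comp ((hM.comp tendsto_fst).prodMk_nhds
      ((continuous_val.tendsto x).comp tendsto_snd))
  have hN : negNorm (M.mulVec x.1) = μ := by
    rw [hx, negNorm_smul hμ.le, p.negNorm_val, mul_one]
  have h2 := (((continuous_negNorm.tendsto _).comp h1).inv₀ (by rw [hN]; exact hμ.ne')).smul h1
  rw [hN, hx, smul_smul, inv_mul_cancel₀ hμ.ne', one_smul] at h2
  exact h2.congr fun q => (act_val _ _ (hs q.1)).symm

theorem tendstoUniformlyOn_act {n : ℕ} {g : ℕ → SO n} {K : Set (Ein n)} (hK : IsCompact K)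
    {p : Ein n} (h : ∀ x ∈ K,
      Tendsto (fun q : ℕ × Ein n => act (g q.1) q.2) (atTop ×ˢ 𝓝 x) (𝓝 p)) :
    TendstoUniformlyOn (fun k => act (g k)) (fun _ => p) atTop K := by
  rw [← tendstoLocallyUniformlyOn_iff_tendstoUniformlyOn_of_compact hK,
    tendstoLocallyUniformlyOn_iff_forall_tendsto]
  intro x hx
  exact (tendsto_const_nhds.prodMk_nhds
    ((h x hx).mono_left (prod_mono le_rfl nhdsWithin_le_nhds))).mono_right (nhds_le_uniformity p)

theorem convergesToPole {n : ℕ} {g : ℕ → SO n} {s : ℕ → ℝ} (hs : ∀ k, 0 < s k)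
    {M : Matrix (Fin 2 ⊕ Fin n) (Fin 2 ⊕ Fin n) ℝ}
    (hM : Tendsto (fun k => s k • (g k).1.1) atTop (𝓝 M)) {xplus xminus : Ein n} {c : ℝ}
    (hc : c < 0) (hMv : ∀ v, M.mulVec v = (c * form v xminus.1) • xplus.1) :
    ConvergesToPole g xplus xminus := by
  refine ⟨fun K hK hsub => tendstoUniformlyOn_act hK fun x hx => ?_,
    fun K hK hsub => tendstoUniformlyOn_act hK fun x hx => ?_⟩
  · exact tendsto_act hs hM (mul_pos_of_neg_of_neg hc (hsub hx)) (hMv _)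
  · refine tendsto_act hs hM (μ := -(c * form x.1 xminus.1))
      (neg_pos.2 (mul_neg_of_neg_of_pos hc (hsub hx))) ?_
    rw [hMv, neg_val, neg_smul_neg]

/-- Rescaling multiplies the preserved form by `s k ^ 2`, which tends to zero. -/
theorem form_mulVec_eq_zero {n : ℕ} {g : ℕ → SO n} {s : ℕ → ℝ} (hs0 : Tendsto s atTop (𝓝 0))
    {M : Matrix (Fin 2 ⊕ Fin n) (Fin 2 ⊕ Fin n) ℝ}
    (hM : Tendsto (fun k => s k • (g k).1.1) atTop (𝓝 M)) (v w : V n) :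
    form (M.mulVec v) (M.mulVec w) = 0 := by
  have hc : Continuous fun A : Matrix (Fin 2 ⊕ Fin n) (Fin 2 ⊕ Fin n) ℝ =>
      form (A.mulVec v) (A.mulVec w) := continuous_form.comp
    ((continuous_id.matrix_mulVec continuous_const).prodMk
      (continuous_id.matrix_mulVec continuous_const))
  have h1 := (hc.tendsto M).comp hM
  have h2 : Tendsto (fun k => s k * (s k * form v w)) atTop (𝓝 (0 * (0 * form v w))) :=
    hs0.mul (hs0.mul_const _)
  rw [zero_mul] at h2
  refine tendsto_nhds_unique h1 (h2.congr fun k => ?_)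
  simp only [Function.comp_apply, Matrix.smul_mulVec, form_smul_left, form_smul_right, (g k).2.1]

/-! ### Rank one limits -/

/-- Limits of points of `Λ` along the action lie in `Λ` and on the totally isotropic image of `M`;
distinct points of `Λ` are never orthogonal, so only one limit is possible. -/
theorem exists_limit_ray {n : ℕ} {Λ : Set (Ein n)}
    (hneg : ∀ x ∈ Λ, ∀ y ∈ Λ, x ≠ y → form x.1 y.1 < 0)
    (hsph : Nonempty (Λ ≃ₜ Metric.sphere (0 : EuclideanSpace ℝ (Fin n)) 1))
    {g : ℕ → SO n} (hinv : ∀ k, MapsTo (act (g k)) Λ Λ) {s : ℕ → ℝ} (hs : ∀ k, 0 < s k)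
    {M : Matrix (Fin 2 ⊕ Fin n) (Fin 2 ⊕ Fin n) ℝ} (hM0 : adj M ≠ 0)
    (hM : Tendsto (fun k => s k • (g k).1.1) atTop (𝓝 M))
    (hiso : ∀ v w, form (M.mulVec v) (M.mulVec w) = 0)
    (hiso' : ∀ v w, form ((adj M).mulVec v) ((adj M).mulVec w) = 0) :
    ∃ p ∈ Λ, (∀ y ∈ Λ, ∃ μ : ℝ, M.mulVec y.1 = μ • p.1) ∧
      ∃ y ∈ Λ, ∃ μ : ℝ, 0 < μ ∧ M.mulVec y.1 = μ • p.1 := by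
  have hclosed : IsClosed Λ := by
    obtain ⟨h⟩ := hsph
    have : CompactSpace Λ := h.symm.compactSpace
    exact (isCompact_iff_compactSpace.2 this).isClosed
  have hlim : ∀ y ∈ Λ, M.mulVec y.1 ≠ 0 →
      ∃ p ∈ Λ, ∃ μ : ℝ, 0 < μ ∧ M.mulVec y.1 = μ • p.1 := by
    intro y hy h0
    obtain ⟨p, μ, hμ, hp⟩ := exists_ein_of_isotropic h0 (hiso _ _)
    refine ⟨p, ?_, μ, hμ, hp⟩
    have hpair : Tendsto (fun k : ℕ => (k, y)) atTop (atTop ×ˢ 𝓝 y) :=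
      tendsto_id.prodMk tendsto_const_nhds
    have hact := tendsto_act hs hM (x := y) (p := p) hμ hp
    have ht := hact.comp hpair
    refine hclosed.mem_of_tendsto ht (Eventually.of_forall fun k => ?_)
    exact hinv k hy
  -- To find `y ∈ Λ` not killed by `M`, pair `M y` with `w`: this is the product of `y` with the
  -- isotropic vector `adj M w`, whose orthogonal hyperplane cannot contain `Λ`.
  obtain ⟨w, hw⟩ : ∃ w, (adj M).mulVec w ≠ 0 := by
    by_contra! h
    exact hM0 (Matrix.mulVec_injective (funext fun w => by rw [h w, Matrix.zero_mulVec]))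
  obtain ⟨q, c, hc, hq⟩ := exists_ein_of_isotropic hw (hiso' _ _)
  obtain ⟨y, hy, hyq⟩ := exists_form_ne_zero hneg hsph q
  have hMy : M.mulVec y.1 ≠ 0 := by
    intro h
    have : form (M.mulVec y.1) w = c * form y.1 q.1 := by
      rw [form_mulVec_left, hq, form_smul_right]
    rw [h, ← zero_smul ℝ (0 : V n), form_smul_left, zero_mul] at this
    exact mul_ne_zero hc.ne' hyq this.symm
  obtain ⟨p, hp, μ, hμ, hyp⟩ := hlim y hy hMy
  refine ⟨p, hp, fun x hx => ?_, y, hy, μ, hμ, hyp⟩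
  by_cases h0 : M.mulVec x.1 = 0
  · exact ⟨0, by rw [h0, zero_smul]⟩
  · obtain ⟨p', hp', μ', hμ', hxp'⟩ := hlim x hx h0
    have hpp : p' = p := by
      by_contra hne
      have h1 := hiso x.1 y.1
      rw [hxp', hyp, form_smul_left, form_smul_right] at h1
      exact (mul_ne_zero hμ'.ne' (mul_ne_zero hμ.ne' (hneg _ hp' _ hp hne).ne)) h1
    exact ⟨μ', by rw [hxp', hpp]⟩

theorem exists_rank_one_limit {n : ℕ} {Λ : Set (Ein n)}
    (hneg : ∀ x ∈ Λ, ∀ y ∈ Λ, x ≠ y → form x.1 y.1 < 0)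
    (hsph : Nonempty (Λ ≃ₜ Metric.sphere (0 : EuclideanSpace ℝ (Fin n)) 1))
    {g : ℕ → SO n} (hinv : ∀ k, MapsTo (act (g k)) Λ Λ)
    (hinv' : ∀ k, MapsTo (act (g k)⁻¹) Λ Λ) {s : ℕ → ℝ} (hs : ∀ k, 0 < s k)
    (hs0 : Tendsto s atTop (𝓝 0))
    {M : Matrix (Fin 2 ⊕ Fin n) (Fin 2 ⊕ Fin n) ℝ} (hM0 : M ≠ 0)
    (hM : Tendsto (fun k => s k • (g k).1.1) atTop (𝓝 M)) :
    ∃ xplus ∈ Λ, ∃ xminus ∈ Λ, ∃ c : ℝ, c < 0 ∧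
      (∀ v, M.mulVec v = (c * form v xminus.1) • xplus.1) ∧
      ∀ v, (adj M).mulVec v = (c * form v xplus.1) • xminus.1 := by
  have hadj : adj (adj M) = M := by
    ext i j
    simp only [adj, Matrix.of_apply]
    linear_combination M i j * signature n i * signature n i * signature_mul_self j
      + M i j * signature_mul_self i
  have hN0 : adj M ≠ 0 := by
    intro h
    apply hM0
    rw [← hadj, h]
    ext i j
    simp [adj]
  have hN : Tendsto (fun k => s k • ((g k)⁻¹).1.1) atTop (𝓝 (adj M)) := by
    refine ((continuous_adj.tendsto M).comp hM).congr fun k => ?_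
    rw [Function.comp_apply, adj_smul, val_inv]
  have hiso := form_mulVec_eq_zero hs0 hM
  have hiso' := form_mulVec_eq_zero hs0 hN
  obtain ⟨p, hp, hpall, -⟩ := exists_limit_ray hneg hsph hinv hs hN0 hM hiso hiso'
  obtain ⟨q, hq, -, y, hy, μ, hμ, hyq⟩ := exists_limit_ray hneg hsph hinv' hs
    (by rwa [hadj]) hN hiso' (by rwa [hadj])
  -- All products of `adj M w` with `Λ` equal products of `w` with multiples of `p`, hence vanish,
  -- so the isotropic vector `adj M w` is zero.
  have hker : ∀ w, form p.1 w = 0 → (adj M).mulVec w = 0 := by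
    intro w hw
    by_contra h0
    obtain ⟨x, c, hc, hx⟩ := exists_ein_of_isotropic h0 (hiso' _ _)
    obtain ⟨z, hz, hzx⟩ := exists_form_ne_zero hneg hsph x
    obtain ⟨ν, hν⟩ := hpall z hz
    have h1 : form (M.mulVec z.1) w = c * form z.1 x.1 := by
      rw [form_mulVec_left, hx, form_smul_right]
    rw [hν, form_smul_left, hw, mul_zero] at h1
    exact mul_ne_zero hc.ne' hzx h1.symm
  have hpy : form p.1 y.1 < 0 := by
    refine hneg p hp y hy fun h => ?_
    have := hker y.1 (by rw [h]; exact y.form_self_eq_zero)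
    rw [this] at hyq
    exact smul_ne_zero hμ.ne' q.val_ne_zero hyq.symm
  -- Split `v` along `y` and the kernel `p^⊥`. The coefficient `μ / form p y` is negative because
  -- `form p y < 0`, which fixes the sign of `c`.
  have hadjv : ∀ v, (adj M).mulVec v = (μ / form p.1 y.1 * form v p.1) • q.1 := by
    intro v
    have h1 := hker (v + (-(form p.1 v / form p.1 y.1)) • y.1) (by
      rw [form_add_right, form_smul_right, neg_mul, div_mul_cancel₀ _ hpy.ne, add_neg_cancel])
    rw [Matrix.mulVec_add, Matrix.mulVec_smul, hyq, neg_smul, ← sub_eq_add_neg, sub_eq_zero,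
      smul_smul] at h1
    rw [h1, form_comm v]
    congr 1
    ring
  refine ⟨p, hp, q, hq, μ / form p.1 y.1, div_neg_of_pos_of_neg hμ hpy, fun v => ?_, hadjv⟩
  refine ext_form_right fun w => ?_
  rw [form_comm, form_mulVec_left, hadjv, form_smul_right, form_smul_right]
  ring

/-! ### Passage to `ℝ^{2,n+1}` and existence of poles -/

theorem form_emb_right {n : ℕ} (v : V (n + 1)) (x : Ein n) :
    form v (emb x).1 = form (fun k => v (splitLast n (Sum.inl k))) x.1 := by
  rw [form_splitLast]
  simp [emb]

theorem form_emb_emb {n : ℕ} (x y : Ein n) : form (emb x).1 (emb y).1 = form x.1 y.1 := by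
  rw [form_emb_right]
  simp [emb]

/-- The entry `1` on the fixed coordinate becomes `s k` after rescaling, so it disappears in the
limit. -/
theorem tendsto_smul_incl {n : ℕ} {g : ℕ → SO n} {s : ℕ → ℝ} (hs0 : Tendsto s atTop (𝓝 0))
    {M : Matrix (Fin 2 ⊕ Fin n) (Fin 2 ⊕ Fin n) ℝ}
    (hM : Tendsto (fun k => s k • (g k).1.1) atTop (𝓝 M)) :
    Tendsto (fun k => s k • (incl n (g k)).1.1) atTop
      (𝓝 (Matrix.reindex (splitLast n) (splitLast n) (Matrix.fromBlocks M 0 0 0))) := by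
  have hc : Continuous fun q : Matrix (Fin 2 ⊕ Fin n) (Fin 2 ⊕ Fin n) ℝ × ℝ =>
      Matrix.reindex (splitLast n) (splitLast n)
        (Matrix.fromBlocks q.1 0 0 (q.2 • (1 : Matrix (Fin 1) (Fin 1) ℝ))) :=
    (continuous_fst.matrix_fromBlocks continuous_const continuous_const
      (continuous_snd.smul continuous_const)).matrix_reindex _ _
  have h := (hc.tendsto (M, 0)).comp (hM.prodMk_nhds hs0)
  rw [zero_smul] at h
  refine h.congr fun k => ?_
  change _ = s k • Matrix.reindex (splitLast n) (splitLast n) (Matrix.fromBlocks (g k).1.1 0 0 1)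
  ext i j
  obtain ⟨i, rfl⟩ := (splitLast n).surjective i
  obtain ⟨j, rfl⟩ := (splitLast n).surjective j
  rcases i with i | i <;> rcases j with j | j <;> simp

theorem reindex_fromBlocks_mulVec {n : ℕ} {M : Matrix (Fin 2 ⊕ Fin n) (Fin 2 ⊕ Fin n) ℝ}
    {x y : Ein n} {c : ℝ} (h : ∀ v, M.mulVec v = (c * form v y.1) • x.1) (v : V (n + 1)) :
    (Matrix.reindex (splitLast n) (splitLast n)
      (Matrix.fromBlocks M 0 0 (0 : Matrix (Fin 1) (Fin 1) ℝ))).mulVec v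
        = (c * form v (emb y).1) • (emb x).1 := by
  ext k
  obtain ⟨k, rfl⟩ := (splitLast n).surjective k
  rw [form_emb_right]
  have hk := congrFun (h fun k => v (splitLast n (Sum.inl k)))
  simp only [Matrix.mulVec, dotProduct, Pi.smul_apply] at hk
  simp only [Matrix.mulVec, dotProduct, Matrix.reindex_apply, Matrix.submatrix_apply,
    Equiv.symm_apply_apply, Pi.smul_apply]
  rw [← Equiv.sum_comp (splitLast n)]
  rcases k with k | k
  · simp [Fintype.sum_sum_type, hk, emb]
  · simp [Fintype.sum_sum_type, emb]

theorem exists_isPolePair {n : ℕ} {Γ : Type*} [Group Γ] {ρ : Γ →* SO₀ n} {Λ : Set (Ein n)}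
    (hρ : IsGHCRegular ρ Λ) (hneg : ∀ x ∈ Λ, ∀ y ∈ Λ, x ≠ y → form x.1 y.1 < 0)
    {γ : ℕ → Γ} (hγ : Tendsto γ atTop cofinite) :
    ∃ φ : ℕ → ℕ, StrictMono φ ∧ ∃ xplus ∈ Λ, ∃ xminus ∈ Λ,
      IsPolePair (fun k => incl n (ρ (γ (φ k))).1) (emb xplus) (emb xminus) := by
  have hnorm : Tendsto (fun k => ‖(ρ (γ k)).1.1.1‖) atTop atTop :=
    (tendsto_norm_atTop hρ.faithful hρ.discrete).comp hγ
  obtain ⟨M, hM1, φ, hφ, hM⟩ := (isCompact_sphere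
    (0 : Matrix (Fin 2 ⊕ Fin n) (Fin 2 ⊕ Fin n) ℝ) 1).tendsto_subseq
    (x := fun k => ‖(ρ (γ k)).1.1.1‖⁻¹ • (ρ (γ k)).1.1.1) (fun k => by
      rw [mem_sphere_zero_iff_norm, norm_smul, norm_inv, norm_norm,
        inv_mul_cancel₀ (norm_val_pos _).ne'])
  have hM0 : M ≠ 0 := by
    rintro rfl
    simp at hM1
  set s : ℕ → ℝ := fun k => ‖(ρ (γ (φ k))).1.1.1‖⁻¹
  have hs : ∀ k, 0 < s k := fun k => inv_pos.2 (norm_val_pos _)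
  have hs0 : Tendsto s atTop (𝓝 0) := (hnorm.comp hφ.tendsto_atTop).inv_tendsto_atTop
  have hmaps : ∀ γ : Γ, MapsTo (act (ρ γ).1) Λ Λ := fun γ x hx => by
    rw [← hρ.invariant γ]
    exact mem_image_of_mem _ hx
  have hmaps' : ∀ γ : Γ, MapsTo (act (ρ γ).1⁻¹) Λ Λ := fun γ => by
    have := hmaps γ⁻¹
    rwa [map_inv] at this
  obtain ⟨xp, hxp, xm, hxm, c, hc, hMv, hNv⟩ := exists_rank_one_limit hneg hρ.sphere
    (g := fun k => (ρ (γ (φ k))).1) (fun k => hmaps _) (fun k => hmaps' _) hs hs0 hM0 hM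
  have hN : Tendsto (fun k => s k • ((ρ (γ (φ k))).1⁻¹).1.1) atTop (𝓝 (adj M)) := by
    refine ((continuous_adj.tendsto M).comp hM).congr fun k => ?_
    rw [Function.comp_apply, Function.comp_apply, adj_smul, val_inv]
  refine ⟨φ, hφ, xp, hxp, xm, hxm, ?_, ?_, ?_⟩
  · rw [form_emb_emb]
    -- The two poles may coincide, in which case the product is zero rather than negative.
    by_cases h : xp = xm
    · rw [h, xm.form_self_eq_zero]
    · exact (hneg _ hxp _ hxm h).le
  · exact convergesToPole hs (tendsto_smul_incl (g := fun k => (ρ (γ (φ k))).1) hs0 hM) hc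
      (reindex_fromBlocks_mulVec hMv)
  · simp only [← map_inv]
    exact convergesToPole hs (tendsto_smul_incl (g := fun k => (ρ (γ (φ k))).1⁻¹) hs0 hN) hc
      (reindex_fromBlocks_mulVec hNv)

/-! ### Balanced distortion -/

theorem act_injective {n : ℕ} (g : SO n) : Function.Injective (act g) := by
  intro x y hxy
  have hpos : ∀ x : Ein n, 0 < negNorm (g.1.1.mulVec x.1) := fun x =>
    Real.sqrt_pos.2 (sum_sq_pos_of_isotropic _ (image_ne_zero g x) (form_image g x))
  have h1 : (negNorm (g.1.1.mulVec x.1))⁻¹ • g.1.1.mulVec x.1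
      = (negNorm (g.1.1.mulVec y.1))⁻¹ • g.1.1.mulVec y.1 := congrArg Subtype.val hxy
  set a := negNorm (g.1.1.mulVec x.1)
  set b := negNorm (g.1.1.mulVec y.1)
  have h2 := congrArg (adj g.1.1).mulVec h1
  simp only [Matrix.mulVec_smul, Matrix.mulVec_mulVec, adj_mul_self, Matrix.one_mulVec] at h2
  have h3 := congrArg negNorm h2
  rw [negNorm_smul (inv_pos.2 (hpos x)).le, negNorm_smul (inv_pos.2 (hpos y)).le,
    x.negNorm_val, y.negNorm_val, mul_one, mul_one] at h3
  rw [h3] at h2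
  exact ein_ext (smul_right_injective _ (inv_pos.2 (hpos y)).ne' h2)

theorem form_eq_zero_of_isotropic {m : ℕ} {P : Submodule ℝ (V m)} (hP : ∀ v ∈ P, form v v = 0)
    {v w : V m} (hv : v ∈ P) (hw : w ∈ P) : form v w = 0 := by
  have h := hP _ (P.add_mem hv hw)
  rw [form_add_left, form_add_right, form_add_right, hP v hv, hP w hw, form_comm w v] at h
  linarith

theorem IsPhoton.isClosed {m : ℕ} {Δ : Set (Ein m)} (h : IsPhoton Δ) : IsClosed Δ := by
  obtain ⟨P, -, -, rfl⟩ := h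
  exact P.closed_of_finiteDimensional.preimage continuous_val

/-- A photon contains a point outside any pair of opposite points. -/
theorem IsPhoton.exists_ne {m : ℕ} {Δ : Set (Ein m)} (h : IsPhoton Δ) (x : Ein m) :
    ∃ p ∈ Δ, p ≠ x ∧ p ≠ -x := by
  obtain ⟨P, hP2, hP, rfl⟩ := h
  have hnot : ¬ P ≤ Submodule.span ℝ {x.1} := by
    intro hle
    have := Submodule.finrank_mono hle
    rw [hP2, finrank_span_singleton x.val_ne_zero] at this
    omega
  obtain ⟨v, hv, hvx⟩ := SetLike.not_le_iff_exists.1 hnot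
  have hv0 : v ≠ 0 := by
    rintro rfl
    exact hvx (Submodule.zero_mem _)
  obtain ⟨p, c, hc, rfl⟩ := exists_ein_of_isotropic hv0 (hP v hv)
  have hx := Submodule.mem_span_singleton_self (R := ℝ) x.1
  refine ⟨p, ?_, ?_, ?_⟩
  · have := P.smul_mem c⁻¹ hv
    rwa [smul_smul, inv_mul_cancel₀ hc.ne', one_smul] at this
  · rintro rfl
    exact hvx (Submodule.smul_mem _ _ hx)
  · rintro rfl
    exact hvx (Submodule.smul_mem _ _ (Submodule.neg_mem _ hx))

/-- The points of the cone at time `t` in the opposite directions `e` and `-e` have product `-2 sin²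
t ≠ 0`, so they cannot both lie in a totally isotropic plane. -/
theorem exists_mem_pastCone_diff {m : ℕ} (hm : 2 ≤ m) {Δ : Set (Ein m)} (h : IsPhoton Δ) (θ : ℝ)
    (z : Metric.sphere (0 : EuclideanSpace ℝ (Fin m)) 1) {t : ℝ} (ht : t ∈ Ioo 0 Real.pi) :
    ∃ w, proj (θ - t, w) ∈ pastCone (proj (θ, z)) \ Δ := by
  obtain ⟨P, -, hP, rfl⟩ := h
  have hz := mem_sphere_zero_iff_norm.1 z.2
  obtain ⟨e, he, hze⟩ := exists_unit_orthogonal hm z.1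
  let e' : Metric.sphere (0 : EuclideanSpace ℝ (Fin m)) 1 := ⟨e, mem_sphere_zero_iff_norm.2 he⟩
  have hnorm : ∀ f : EuclideanSpace ℝ (Fin m), ‖f‖ = 1 → inner ℝ z.1 f = 0 →
      Real.cos t • z.1 + Real.sin t • f ∈ Metric.sphere (0 : EuclideanSpace ℝ (Fin m)) 1 := by
    intro f hf hzf
    rw [mem_sphere_zero_iff_norm, ← sq_eq_sq₀ (norm_nonneg _) zero_le_one, norm_add_sq_real,
      norm_smul, norm_smul, hz, hf, inner_smul_left, inner_smul_right, hzf]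
    simp
  have hze' : inner ℝ z.1 (-e) = 0 := by rw [inner_neg_right, hze, neg_zero]
  have hmem : ∀ (f : Metric.sphere (0 : EuclideanSpace ℝ (Fin m)) 1) (hf : inner ℝ z.1 f.1 = 0),
      proj (θ - t, ⟨_, hnorm f.1 (mem_sphere_zero_iff_norm.1 f.2) hf⟩) ∈ pastCone (proj (θ, z)) := by
    intro f hf
    exact ⟨θ, z, f, t, rfl, hf, ⟨ht.1.le, ht.2.le⟩, rfl⟩
  by_contra! hcon
  have h1 : (proj (θ - t, ⟨_, hnorm e'.1 (mem_sphere_zero_iff_norm.1 e'.2) hze⟩)).1 ∈ P := by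
    by_contra hn
    exact hcon _ ⟨hmem e' hze, hn⟩
  have h2 : (proj (θ - t, ⟨_, hnorm (-e').1 (mem_sphere_zero_iff_norm.1 (-e').2) hze'⟩)).1 ∈ P := by
    by_contra hn
    exact hcon _ ⟨hmem (-e') hze', hn⟩
  have h3 := form_eq_zero_of_isotropic hP h1 h2
  rw [form_proj] at h3
  have h4 : inner ℝ e (z.1) = 0 := by rw [real_inner_comm, hze]
  have h5 : (-e').1 = -e := rfl
  simp only [sub_self, Real.cos_zero, h5, inner_add_left, inner_add_right, inner_smul_left,
    inner_smul_right, inner_neg_right, real_inner_self_eq_norm_sq, hz, conj_trivial, e', he, hze,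
    h4] at h3
  have hs := Real.sin_pos_of_pos_of_lt_pi ht.1 ht.2
  nlinarith [Real.sin_sq_add_cos_sq t]

theorem ConvergesToPhoton.exists_fiber {m : ℕ} {g : ℕ → SO m} {Δplus Δminus : Set (Ein m)}
    (h : ConvergesToPhoton g Δplus Δminus) :
    ∃ π : Ein m → Ein m, ContinuousOn π Δminusᶜ ∧
      (∀ p ∈ Δplus, ∃ x ∈ Δminus, ∀ y ∈ pastCone x \ Δminus, π y = p) ∧
      ∀ y ∈ Δminusᶜ, Tendsto (fun k => act (g k) y) atTop (𝓝 (π y)) := by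
  obtain ⟨π, hπ, -, hfib, hconv⟩ := h
  refine ⟨π, hπ, fun p hp => ?_, fun y hy => ?_⟩
  · obtain ⟨x, hx, heq⟩ := hfib p hp
    refine ⟨x, hx, fun y hy => ?_⟩
    rw [← heq] at hy
    exact hy.2
  · exact (hconv {y} isCompact_singleton (singleton_subset_iff.2 hy)).tendsto_at
      (mem_singleton y)

/-- The limit map would coincide off `Δ⁻` with the injective action of `a`, yet a fiber contains two
points of the same past cone. -/
theorem not_convergesToPhoton_of_const_subseq {m : ℕ} (hm : 2 ≤ m) {g : ℕ → SO m}
    {Δplus Δminus : Set (Ein m)} (hplus : IsPhoton Δplus) (hminus : IsPhoton Δminus)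
    {φ : ℕ → ℕ} (hφ : Tendsto φ atTop atTop) {a : SO m} (ha : ∀ k, g (φ k) = a) :
    ¬ ConvergesToPhoton g Δplus Δminus := by
  intro h
  obtain ⟨π, -, hfib, hconv⟩ := h.exists_fiber
  have hact : ∀ y ∈ Δminusᶜ, π y = act a y := by
    intro y hy
    refine tendsto_nhds_unique ((hconv y hy).comp hφ) (tendsto_const_nhds.congr fun k => ?_)
    rw [Function.comp_apply, ha]
  -- The excluded point is arbitrary: only some element of `Δ⁺` is needed.
  obtain ⟨p, hp, -⟩ := hplus.exists_ne (proj (0, ⟨EuclideanSpace.single ⟨0, by omega⟩ 1, by simp⟩))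
  obtain ⟨x, -, hx⟩ := hfib p hp
  obtain ⟨⟨θ, z⟩, rfl⟩ := proj_surjective x
  have hpi := Real.pi_pos
  obtain ⟨w, hw⟩ := exists_mem_pastCone_diff hm hminus θ z (t := Real.pi / 2)
    ⟨by linarith, by linarith⟩
  -- The parameters `π / 2` and `π / 6` give time coordinates differing by `π / 3`, whose cosine is
  -- not `1`; hence the points differ.
  obtain ⟨w', hw'⟩ := exists_mem_pastCone_diff hm hminus θ z (t := Real.pi / 6)
    ⟨by linarith, by linarith⟩
  have heq : proj (θ - Real.pi / 2, w) = proj (θ - Real.pi / 6, w') := by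
    apply act_injective a
    rw [← hact _ hw.2, ← hact _ hw'.2, hx _ hw, hx _ hw']
  have h1 := congrFun (congrArg Subtype.val heq) (Sum.inl 0)
  have h2 := congrFun (congrArg Subtype.val heq) (Sum.inl 1)
  simp only [proj, Sum.elim_inl, Matrix.cons_val_zero, Matrix.cons_val_one] at h1 h2
  have h3 : Real.cos ((θ - Real.pi / 6) - (θ - Real.pi / 2)) = 1 := by
    rw [Real.cos_sub, h1, h2]
    linarith [Real.sin_sq_add_cos_sq (θ - Real.pi / 6)]
  rw [show (θ - Real.pi / 6) - (θ - Real.pi / 2) = Real.pi / 3 by ring, Real.cos_pi_div_three] at h3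
  norm_num at h3

theorem continuous_proj {n : ℕ} : Continuous (proj (n := n)) := by
  refine isInducing_val.continuous_iff.2 (continuous_pi fun k => ?_)
  rcases k with i | j
  · fin_cases i
    · exact Real.continuous_cos.comp continuous_fst
    · exact Real.continuous_sin.comp continuous_fst
  · exact (EuclideanSpace.proj (𝕜 := ℝ) j).continuous.comp
      (continuous_subtype_val.comp continuous_snd)

/-- Moving `y` in time by `s` and `-s` changes only the cosine term, and no cosine is equal at three
points `α`, `α + s`, `α - s` with `0 < s < π`. -/
theorem frequently_form_ne_zero {n : ℕ} (x y : Ein n) : ∃ᶠ y' in 𝓝 y, form y'.1 x.1 ≠ 0 := by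
  intro hev
  simp only [not_not] at hev
  obtain ⟨⟨θ, z⟩, rfl⟩ := proj_surjective y
  obtain ⟨⟨η, w⟩, rfl⟩ := proj_surjective x
  have hpath : Tendsto (fun s : ℝ => proj (θ + s, z)) (𝓝 0) (𝓝 (proj (θ, z))) := by
    have hc : Continuous fun s : ℝ => proj (θ + s, z) := continuous_proj.comp
      ((continuous_const.add continuous_id).prodMk continuous_const)
    simpa using hc.tendsto 0
  have h1 := hpath.eventually hev
  have h0 := h1.self_of_nhds
  have hneg : Tendsto (fun s : ℝ => -s) (𝓝 0) (𝓝 0) := by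
    simpa using (continuous_neg (G := ℝ)).tendsto 0
  obtain ⟨s, ⟨⟨hs1, hs2⟩, hsπ⟩, hs0⟩ := (((h1.and (hneg.eventually h1)).and
    (eventually_lt_nhds Real.pi_pos)).filter_mono nhdsWithin_le_nhds |>.and
    (self_mem_nhdsWithin (s := Ioi (0 : ℝ)))).exists
  simp only [form_proj] at h0 hs1 hs2
  rw [show θ + 0 - η = θ - η by ring] at h0
  rw [show θ + s - η = (θ - η) + s by ring, Real.cos_add] at hs1
  rw [show θ + -s - η = (θ - η) - s by ring, Real.cos_sub] at hs2
  have hsin := Real.sin_pos_of_pos_of_lt_pi hs0 hsπ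
  have h2 : Real.sin (θ - η) = 0 := by
    have : Real.sin (θ - η) * Real.sin s = 0 := by linarith
    exact (mul_eq_zero.1 this).resolve_right hsin.ne'
  have h3 : Real.cos (θ - η) * (1 - Real.cos s) = 0 := by linarith
  rcases mul_eq_zero.1 h3 with h4 | h4
  · have := Real.sin_sq_add_cos_sq (θ - η)
    rw [h2, h4] at this
    norm_num at this
  · have := Real.sin_sq_add_cos_sq s
    rw [← sub_eq_zero.1 h4] at this
    nlinarith

/-- Off `Δ⁻` and the hyperplane `x⁻^⊥` the limit map takes only the values `±x⁺`. A point of the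
photon `Δ⁺` other than these has a nonempty fiber, and near it continuity keeps the map away from
`±x⁺`, although the complement of the hyperplane is dense. -/
theorem not_convergesToPhoton_of_poles {m : ℕ} (hm : 2 ≤ m) {g : ℕ → SO m}
    {Δplus Δminus : Set (Ein m)} (hplus : IsPhoton Δplus) (hminus : IsPhoton Δminus)
    {φ : ℕ → ℕ} (hφ : Tendsto φ atTop atTop) {xplus xminus : Ein m}
    (hpole : ConvergesToPole (fun k => g (φ k)) xplus xminus) :
    ¬ ConvergesToPhoton g Δplus Δminus := by
  intro h
  obtain ⟨π, hπ, hfib, hconv⟩ := h.exists_fiber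
  have hpoles : ∀ y ∈ Δminusᶜ, form y.1 xminus.1 ≠ 0 → π y = xplus ∨ π y = -xplus := by
    intro y hy hne
    have ht := (hconv y hy).comp hφ
    rcases hne.lt_or_gt with hlt | hgt
    · exact Or.inl (tendsto_nhds_unique ht ((hpole.1 {y} isCompact_singleton
        (singleton_subset_iff.2 hlt)).tendsto_at (mem_singleton y)))
    · exact Or.inr (tendsto_nhds_unique ht ((hpole.2 {y} isCompact_singleton
        (singleton_subset_iff.2 hgt)).tendsto_at (mem_singleton y)))
  obtain ⟨p, hp, hp1, hp2⟩ := hplus.exists_ne xplus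
  obtain ⟨x, -, hx⟩ := hfib p hp
  obtain ⟨⟨θ, z⟩, rfl⟩ := proj_surjective x
  have hpi := Real.pi_pos
  obtain ⟨w, hw⟩ := exists_mem_pastCone_diff hm hminus θ z (t := Real.pi / 2)
    ⟨by linarith, by linarith⟩
  set y := proj (θ - Real.pi / 2, w)
  have hnhds : Δminusᶜ ∈ 𝓝 y := hminus.isClosed.isOpen_compl.mem_nhds hw.2
  have hev : ∀ᶠ y' in 𝓝 y, π y' ∉ ({xplus, -xplus} : Set (Ein m)) := by
    refine (hπ.continuousAt hnhds).eventually
      ((toFinite {xplus, -xplus}).isClosed.isOpen_compl.mem_nhds ?_)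
    rw [hx _ hw]
    simp [hp1, hp2]
  obtain ⟨y', hne, hy', hnot⟩ :=
    ((frequently_form_ne_zero xminus y).and_eventually (Filter.Eventually.and hnhds hev)).exists
  exact hnot (hpoles y' hy' hne)

/-- Pigeonhole when the range is finite, distinct values otherwise. The reindexing tends to infinity
but need not be monotone, which suffices for limits. -/
theorem exists_subseq_const_or_cofinite {α : Type*} (u : ℕ → α) :
    ∃ φ : ℕ → ℕ, Tendsto φ atTop atTop ∧
      ((∃ a, ∀ k, u (φ k) = a) ∨ Tendsto (u ∘ φ) atTop cofinite) := by
  by_cases hfin : (range u).Finite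
  · obtain ⟨a, ha⟩ : ∃ a, (u ⁻¹' {a}).Infinite := by
      by_contra! h
      have h1 : (u ⁻¹' range u).Finite := hfin.preimage' fun b _ => h b
      rw [preimage_range] at h1
      exact infinite_univ h1
    refine ⟨fun k => (ha.natEmbedding _ k).1, ?_, Or.inl ⟨a, fun k => (ha.natEmbedding _ k).2⟩⟩
    rw [← Nat.cofinite_eq_atTop]
    exact (Subtype.val_injective.comp (ha.natEmbedding _).injective).tendsto_cofinite
  · have hinf : (range u).Infinite := hfin
    choose φ hφ using fun k => (hinf.natEmbedding _ k).2
    have hu : Function.Injective (u ∘ φ) := by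
      have : u ∘ φ = fun k => (hinf.natEmbedding _ k).1 := funext hφ
      rw [this]
      exact Subtype.val_injective.comp (hinf.natEmbedding _).injective
    refine ⟨φ, ?_, Or.inr ?_⟩
    · rw [← Nat.cofinite_eq_atTop]
      exact hu.of_comp.tendsto_cofinite
    · rw [← Nat.cofinite_eq_atTop]
      exact hu.tendsto_cofinite

end EinAdS
end

/-! ### The theorem -/

theorem mainTheorem5 (n : ℕ) (hn : 2 ≤ n) {Γ : Type*} [Group Γ] (ρ : Γ →* EinAdS.SO₀ n)
    (Λ : Set (EinAdS.Ein n)) (hρ : EinAdS.IsGHCRegular ρ Λ) (hΛ : EinAdS.IsAcausal Λ) :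
    (∀ γ : ℕ → Γ,
      ¬ EinAdS.HasBalancedDistortion (fun k => EinAdS.incl n (ρ (γ k)).1)) ∧
    (∀ γ : ℕ → Γ, Tendsto γ atTop cofinite →
      ∃ φ : ℕ → ℕ, StrictMono φ ∧ ∃ xplus ∈ Λ, ∃ xminus ∈ Λ,
        EinAdS.IsPolePair (fun k => EinAdS.incl n (ρ (γ (φ k))).1)
          (EinAdS.emb xplus) (EinAdS.emb xminus)) := by
  have hneg : ∀ x ∈ Λ, ∀ y ∈ Λ, x ≠ y → EinAdS.form x.1 y.1 < 0 := fun x hx y hy hxy =>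
    EinAdS.form_neg_of_isAcausal hn hΛ hx hy hxy
  refine ⟨fun γ => ?_, fun γ hγ => EinAdS.exists_isPolePair hρ hneg hγ⟩
  rintro ⟨Δplus, Δminus, hplus, hminus, hconv, -⟩
  have hm : 2 ≤ n + 1 := by omega
  obtain ⟨φ, hφ, ⟨a, ha⟩ | hcof⟩ := EinAdS.exists_subseq_const_or_cofinite γ
  · have hconst : ∀ k, EinAdS.incl n (ρ (γ (φ k))).1 = EinAdS.incl n (ρ a).1 := fun k =>
      congrArg (fun b => EinAdS.incl n (ρ b).1) (ha k)
    exact EinAdS.not_convergesToPhoton_of_const_subseq hm hplus hminus hφ hconst hconv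
  · obtain ⟨ψ, hψ, xp, -, xm, -, -, hpole, -⟩ := EinAdS.exists_isPolePair hρ hneg hcof
    exact EinAdS.not_convergesToPhoton_of_poles (g := fun k => EinAdS.incl n (ρ (γ k)).1)
      (φ := φ ∘ ψ) hm hplus hminus (hφ.comp hψ.tendsto_atTop) hpole hconv
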